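/- Let $U^\circ=\{(\alpha,\beta):0<\beta<\alpha<1\}$, let $G(\alpha,\beta)=\left(\frac{\beta}{\alpha},\ \frac{\beta-1}{\alpha}+\left\lfloor\frac1\alpha\right\rfloor\right)$ on $U^\circ$, and let $A=\bigcap_{n\ge0}G^{-n}(U^\circ)$. For $(\alpha,\beta)\in A$ write $(\alpha_n,\beta_n)=G^n(\alpha,\beta)$ and $k_n=\lfloor 1/\alpha_n\rfloor$, i.e. $\frac1{k_n+1}<\alpha_n\le\frac1{k_n}$. Let $T=T_{\alpha,\beta}:[0,1)\to[0,1)$ be $$T(x)=\begin{cases}x+\alpha & x\in[0,1-\alpha)\quad\text{(branch 1)}\\ x+\beta & x\in[1-\alpha,1-\beta)\quad\text{(branch 2)}\\ x+\beta-1 & x\in[1-\beta,1)\quad\text{(branch 3)},\end{cases}$$ let $\Omega=\bigcap_{n\ge0}T^n([0,1))$ be its attractor, and let $\overline\Omega$ be the closure of $\Omega$ in $\mathbb R$. On $\overline\Omega\setminus\Omega$ the map $T$ and its branches are (re)defined by continuity from the left (e.g. $T(1)=\beta$, with branch 3). For $k\ge1$ let $\chi_k$ be the substitution $1\to2$, $2\to31^k$,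 $3\to31^{k-1}$. **Theorem.** (i) $A$ is uncountable, and $(\alpha,\beta)\mapsto k_0k_1k_2\dots$ is a bijection from $A$ onto $$\mathcal K=\{k_0k_1\dots:\ k_i\in\{1,2,3,\dots\},\ k_{2i}\ne1\text{ for infinitely many } i,\ k_{2i+1}\ne1\text{ for infinitely many } i\}.$$ (ii) Let $(\alpha,\beta)\in A$ have code $k=k_0k_1\dots$. Then the words $\chi_{k_0}\circ\chi_{k_1}\circ\cdots\circ\chi_{k_n}(3)$ converge, as $n\to\infty$, to an infinite word $s$. Let $\sigma$ be the left shift and $\Sigma=\overline{\{\sigma^m(s):m\ge0\}}\subset\{1,2,3\}^{\mathbb N}$ (the shift space generated by the chain $\chi_{k_0}\circ\chi_{k_1}\circ\cdots$), and let $h(x)=e_0(x)e_1(x)\dots$ be the itinerary of $x\in\overline\Omega$, where $e_i(x)$ is the number of the branch used at $T^i(x)$. Then $T(\overline\Omega)\subset\overline\Omega$, $\sigma(\Sigma)\subset\Sigma$, $h(\overline\Omega)\subset\Sigma$, and $h\circ T=\sigma\circ h$ on $\overline\Omega$. Moreover $h$ is an isomorphism off a countable set: the set $E=\{x\in\overline\Omega: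 T^i(x)\in\{1-\alpha,1-\beta\}\text{ for some }i\ge0\}$ is countable, $T(\overline\Omega\setminus E)\subset\overline\Omega\setminus E$, $h:\overline\Omega\to\Sigma$ is continuous at every point of $\overline\Omega\setminus E$, $h$ restricts to a homeomorphism from $\overline\Omega\setminus E$ onto its image, and $\Sigma\setminus h(\overline\Omega\setminus E)$ is countable. -/

import Mathlib

/-! ### The parameter triangle, the Gauss map and the coding of parameters -/

/-- The open triangle of parameters `(α, β)` with `0 < β < α < 1`. -/
def triangle : Set (ℝ × ℝ) := {p | 0 < p.2 ∧ p.2 < p.1 ∧ p.1 < 1}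

/-- The Gauss map `G(α, β) = (β / α, (β - 1) / α + ⌊1 / α⌋)`; it is only used on `triangle`. -/
noncomputable def gauss (p : ℝ × ℝ) : ℝ × ℝ :=
  (p.2 / p.1, (p.2 - 1) / p.1 + (⌊1 / p.1⌋ : ℝ))

/-- The set `A` of parameters whose whole `G`-orbit stays in the open triangle. -/
def paramSet : Set (ℝ × ℝ) := {p | ∀ n : ℕ, gauss^[n] p ∈ triangle}

/-- The coding `k_n = ⌊1 / α_n⌋`, where `(α_n, β_n) = G^n(α, β)`; equivalently
`1 / (k_n + 1) < α_n ≤ 1 / k_n`. -/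
noncomputable def code (p : ℝ × ℝ) (n : ℕ) : ℕ := ⌊1 / (gauss^[n] p).1⌋₊

/-- The sequences of positive integers whose even-indexed entries are `≠ 1` infinitely often and
whose odd-indexed entries are `≠ 1` infinitely often. -/
def codeSet : Set (ℕ → ℕ) :=
  {k | (∀ i, 1 ≤ k i) ∧ (∃ᶠ i in Filter.atTop, k (2 * i) ≠ 1) ∧
    (∃ᶠ i in Filter.atTop, k (2 * i + 1) ≠ 1)}

/-! ### The interval translation map and its attractor

The three branches (and the three letters `1, 2, 3`) are numbered by `0, 1, 2 : Fin 3`. -/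

/-- Number of the branch domain `[0, 1 - α)`, `[1 - α, 1 - β)`, `[1 - β, 1)` that contains `x`. -/
noncomputable def branch (p : ℝ × ℝ) (x : ℝ) : Fin 3 :=
  if x < 1 - p.1 then 0 else if x < 1 - p.2 then 1 else 2

/-- Number of the branch that is active immediately to the left of `x`. -/
noncomputable def branchLeft (p : ℝ × ℝ) (x : ℝ) : Fin 3 :=
  if x ≤ 1 - p.1 then 0 else if x ≤ 1 - p.2 then 1 else 2

/-- The translation lengths of the three branches. -/
def translation (p : ℝ × ℝ) : Fin 3 → ℝ := ![p.1, p.2, p.2 - 1]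

/-- The interval translation map `T` on `[0, 1)`. -/
noncomputable def itm (p : ℝ × ℝ) (x : ℝ) : ℝ := x + translation p (branch p x)

/-- The attractor `Ω = ⋂ n, T^n [0, 1)`. -/
def attractor (p : ℝ × ℝ) : Set ℝ := ⋂ n : ℕ, (itm p)^[n] '' Set.Ico 0 1

open Classical in
/-- The branch used at a point of the closure of `Ω`: the usual one on `Ω`, and the one immediately
to the left at the points of the closure outside `Ω`. -/
noncomputable def branchExt (p : ℝ × ℝ) (x : ℝ) : Fin 3 :=
  if x ∈ attractor p then branch p x else branchLeft p x

/-- The map `T` on the closure of `Ω`: it is `T` on `Ω`, and it is (re)defined by continuity from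
the left, i.e. as the left limit of `T`, at the points of the closure outside `Ω`
(for instance `1 ↦ β`). -/
noncomputable def itmExt (p : ℝ × ℝ) (x : ℝ) : ℝ := x + translation p (branchExt p x)

/-- The itinerary of a point of the closure of `Ω`. -/
noncomputable def itinerary (p : ℝ × ℝ) (x : ℝ) (i : ℕ) : Fin 3 :=
  branchExt p ((itmExt p)^[i] x)

/-- The points of the closure of `Ω` whose forward orbit meets `{1 - α, 1 - β}`. -/
def exceptional (p : ℝ × ℝ) : Set ℝ :=
  {x | x ∈ closure (attractor p) ∧
    ∃ i : ℕ, (itmExt p)^[i] x = 1 - p.1 ∨ (itmExt p)^[i] x = 1 - p.2}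

/-! ### The chain of substitutions and its shift space -/

/-- The substitution `χ_k : 1 → 2, 2 → 3 1^k, 3 → 3 1^(k-1)` (letters shifted down by one). -/
def chi (k : ℕ) : Fin 3 → List (Fin 3) :=
  ![[1], 2 :: List.replicate k 0, 2 :: List.replicate (k - 1) 0]

/-- `chain k n w` is the word `χ_{k 0} (χ_{k 1} (⋯ χ_{k (n - 1)} (w)))`. -/
def chain (k : ℕ → ℕ) : ℕ → List (Fin 3) → List (Fin 3)
  | 0, w => w
  | n + 1, w => chain k n (w.flatMap (chi (k n)))

/-- The infinite word `s` is the limit of the words `χ_{k 0} ∘ ⋯ ∘ χ_{k n} (3)`: each entry of `s`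
is the entry at the same position of all these words from some `n` on. -/
def IsChainLimit (k : ℕ → ℕ) (s : ℕ → Fin 3) : Prop :=
  ∀ i : ℕ, ∀ᶠ n in Filter.atTop, (chain k n [2])[i]? = some (s i)

/-- The left shift. -/
def shift (z : ℕ → Fin 3) : ℕ → Fin 3 := fun i => z (i + 1)

/-- The shift space generated by `s`: the closure of the shift orbit of `s` (product topology). -/
def shiftSpace (s : ℕ → Fin 3) : Set (ℕ → Fin 3) :=
  closure (Set.range fun m : ℕ => shift^[m] s)

/-!
Along a `G`-orbit `(α_n, β_n)` the products `ℓ_n = α_0 ⋯ α_{n-1}` determine the parameter, as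
`α = ℓ_1` and `β = ℓ_2`, and they satisfy `ℓ_n = k_n ℓ_{n+1} + ℓ_{n+2} - ℓ_{n+3}`. So parameters with
code `k` correspond to strictly decreasing positive solutions of this recurrence with `ℓ_0 = 1`
(`IsLengthSeq`). The gaps `d_n = ℓ_n - ℓ_{n+1}` satisfy `d_n = (k_n - 1) ℓ_{n+1} + d_{n+2}`; hence
`d_n > 0` for all `n` exactly when letters `≠ 1` recur in both parity classes. A solution exists by
compactness (`exists_seq`). For uniqueness, whenever two letters `≠ 1` of opposite parity are
separated by letters `1` only, the direction of `(d_a, d_{a+1}, ℓ_{a+2})` is known up to a bounded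
factor (`exists_uniform_stage`), so that a fixed proportion of any normalized solution can be
subtracted from any other one (`IsLengthSeq.sub_smul`); iterating, they coincide.

For the dynamics, the first return map of `T` to `[1 - α, 1)` is an affine copy of the map with
parameter `G(α, β)`, and itineraries are related by `χ_{k_0}` (`itinWord_baseMap_one`). Iterating,
the return map to `[1 - ℓ_n, 1)` is a copy of the map with parameter `G^n(α, β)`. As `ℓ_n → 0` and
every orbit enters `[1 - ℓ_n, 1)` within a bounded time, itineraries separate points uniformly
(`exists_abs_sub_lt`), and the itinerary of a point of `Ω` consists of pieces of the words
`χ_{k_0} ⋯ χ_{k_{n-1}}(a)` (`rightItin_mem_shiftSpace`). The points `1 - ℓ_n` lie in `Ω`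
(`zero_mem_attractor`), and their itineraries converge to `s`; so each element of `Σ` is the
itinerary of a point of the closure of `Ω` from the right or from the left, and the two agree off
the exceptional set.

A point of the closure outside `Ω` has its left itinerary as its itinerary, provided that its left
orbit never enters `Ω`. This holds since `T` is injective enough on the closure: a coincidence
between the images of the first two branches would persist under renormalization, with a defect
that grows like `1 / ℓ_n` (`eq_one_sub_fst`, `notMem_attractor_leftItm`).
-/

open Filter Topology

/-! ### Lengths of the renormalization intervals -/

lemma gauss_iterate_mem {p : ℝ × ℝ} (hp : p ∈ paramSet) (n : ℕ) : gauss^[n] p ∈ paramSet := by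
  intro m
  rw [← Function.iterate_add_apply]
  exact hp _

lemma gauss_mem {p : ℝ × ℝ} (hp : p ∈ paramSet) : gauss p ∈ paramSet :=
  gauss_iterate_mem hp 1

lemma mem_triangle {p : ℝ × ℝ} (hp : p ∈ paramSet) : p ∈ triangle := hp 0

lemma code_gauss_iterate (p : ℝ × ℝ) (m n : ℕ) : code (gauss^[m] p) n = code p (n + m) := by
  simp only [code, Function.iterate_add_apply]

lemma code_gauss (p : ℝ × ℝ) (n : ℕ) : code (gauss p) n = code p (n + 1) :=
  code_gauss_iterate p 1 n

lemma fst_mul_gauss_fst {p : ℝ × ℝ} (hp : p ∈ triangle) : p.1 * (gauss p).1 = p.2 := by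
  have h : p.1 ≠ 0 := (hp.1.trans hp.2.1).ne'
  simp only [gauss]
  field_simp

lemma fst_mul_gauss_snd {p : ℝ × ℝ} (hp : p ∈ triangle) :
    p.1 * (gauss p).2 = p.2 - 1 + code p 0 * p.1 := by
  have h0 : 0 < p.1 := hp.1.trans hp.2.1
  have h : (code p 0 : ℝ) = (⌊1 / p.1⌋ : ℝ) := by
    simp only [code, Function.iterate_zero, id]
    exact natCast_floor_eq_intCast_floor (by positivity)
  simp only [gauss, h]
  field_simp

lemma one_le_code {p : ℝ × ℝ} (hp : p ∈ paramSet) (n : ℕ) : 1 ≤ code p n := by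
  have h := hp n
  refine Nat.le_floor ?_
  rw [Nat.cast_one, one_le_div (h.1.trans h.2.1)]
  exact h.2.2.le

/-- The length `ℓ_n = α_0 α_1 ⋯ α_{n-1}` of the interval `[1 - ℓ_n, 1)` on which the first return
map of `T` is a copy of `T_{G^n(α, β)}`. -/
noncomputable def baseLength (p : ℝ × ℝ) (n : ℕ) : ℝ := ∏ i ∈ Finset.range n, (gauss^[i] p).1

@[simp] lemma baseLength_zero (p : ℝ × ℝ) : baseLength p 0 = 1 := by simp [baseLength]

lemma baseLength_succ (p : ℝ × ℝ) (n : ℕ) :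
    baseLength p (n + 1) = baseLength p n * (gauss^[n] p).1 := Finset.prod_range_succ _ _

lemma baseLength_succ' (p : ℝ × ℝ) (n : ℕ) :
    baseLength p (n + 1) = p.1 * baseLength (gauss p) n := by
  simp only [baseLength, Finset.prod_range_succ', Function.iterate_succ_apply]
  rw [mul_comm]; rfl

lemma baseLength_pos {p : ℝ × ℝ} (hp : p ∈ paramSet) (n : ℕ) : 0 < baseLength p n :=
  Finset.prod_pos fun i _ => (hp i).1.trans (hp i).2.1

lemma baseLength_add_two {p : ℝ × ℝ} (hp : p ∈ paramSet) (n : ℕ) :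
    baseLength p (n + 2) = baseLength p n * (gauss^[n] p).2 := by
  rw [baseLength_succ, baseLength_succ, Function.iterate_succ_apply', mul_assoc,
    fst_mul_gauss_fst (hp n)]

lemma baseLength_succ_lt {p : ℝ × ℝ} (hp : p ∈ paramSet) (n : ℕ) :
    baseLength p (n + 1) < baseLength p n := by
  rw [baseLength_succ]
  exact mul_lt_of_lt_one_right (baseLength_pos hp n) (hp n).2.2

/-- The nonnegative nonincreasing solutions of `ℓ_n = k_n ℓ_{n+1} + ℓ_{n+2} - ℓ_{n+3}`. Up to
scaling they are the sequences of base lengths of the parameters with code `k`. -/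
structure IsLengthSeq (k : ℕ → ℕ) (l : ℕ → ℝ) : Prop where
  nonneg : ∀ n, 0 ≤ l n
  succ_le : ∀ n, l (n + 1) ≤ l n
  eq : ∀ n, l n = k n * l (n + 1) + l (n + 2) - l (n + 3)

lemma isLengthSeq_baseLength {p : ℝ × ℝ} (hp : p ∈ paramSet) :
    IsLengthSeq (code p) (baseLength p) where
  nonneg n := (baseLength_pos hp n).le
  succ_le n := (baseLength_succ_lt hp n).le
  eq n := by
    have h1 := fst_mul_gauss_snd (hp n)
    rw [code_gauss_iterate, zero_add] at h1
    rw [show n + 3 = (n + 1) + 2 from rfl, baseLength_add_two hp, baseLength_add_two hp,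
      baseLength_succ, Function.iterate_succ_apply']
    linear_combination baseLength p n * h1

namespace IsLengthSeq

variable {k : ℕ → ℕ} {l m : ℕ → ℝ}

/-- The recurrence for the gaps `d_n = ℓ_n - ℓ_{n+1}`: `d_n = (k_n - 1) ℓ_{n+1} + d_{n+2}`. -/
lemma gap_eq (h : IsLengthSeq k l) (n : ℕ) :
    l n - l (n + 1) = ((k n : ℝ) - 1) * l (n + 1) + (l (n + 2) - l (n + 3)) := by
  rw [h.eq n]; ring

lemma gap_nonneg (h : IsLengthSeq k l) (n : ℕ) : 0 ≤ l n - l (n + 1) := sub_nonneg.2 (h.succ_le n)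

lemma antitone (h : IsLengthSeq k l) : Antitone l := antitone_nat_of_succ_le h.succ_le

lemma pos (h : IsLengthSeq k l) (h0 : 0 < l 0) (n : ℕ) : 0 < l n := by
  induction n with
  | zero => exact h0
  | succ n ih =>
    have h1 := h.eq n
    have h2 := h.succ_le (n + 1)
    have h3 := h.nonneg (n + 3)
    by_contra hc
    have h4 : l (n + 1) = 0 := le_antisymm (not_lt.1 hc) (h.nonneg _)
    have h5 := h.nonneg (n + 2)
    rw [h4, mul_zero] at h1
    linarith

/-- If all letters of one parity class are `1` from `n` on, the gaps of this class are constant. -/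
lemma gap_const (h : IsLengthSeq k l) {n : ℕ} (hk : ∀ j, k (n + 2 * j) = 1) (j : ℕ) :
    l (n + 2 * j) - l (n + 2 * j + 1) = l n - l (n + 1) := by
  induction j with
  | zero => rfl
  | succ j ih =>
    have h1 := h.gap_eq (n + 2 * j)
    rw [hk, Nat.cast_one, sub_self, zero_mul, zero_add] at h1
    rw [← ih, h1]; rfl

/-- A solution with a positive gap at `n` has a letter `≠ 1` in the parity class of `n` later on:
otherwise infinitely many disjoint gaps would have the same length. -/
lemma exists_ne_one (h : IsLengthSeq k l) {n : ℕ} (hd : 0 < l n - l (n + 1)) :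
    ∃ j, k (n + 2 * j) ≠ 1 := by
  by_contra! hk
  have key : ∀ j : ℕ, (j : ℝ) * (l n - l (n + 1)) ≤ l n - l (n + 2 * j) := by
    intro j
    induction j with
    | zero => simp
    | succ j ih =>
      have h1 := h.gap_const hk j
      have h2 := h.succ_le (n + 2 * j + 1)
      rw [show n + 2 * (j + 1) = n + 2 * j + 1 + 1 by ring]
      push_cast
      linarith
  obtain ⟨j, hj⟩ := exists_nat_gt (l n / (l n - l (n + 1)))
  rw [div_lt_iff₀ hd] at hj
  have := h.nonneg (n + 2 * j)
  linarith [key j]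

/-- Conversely, a letter `≠ 1` in the parity class of `n` forces a positive gap. -/
lemma gap_pos (h : IsLengthSeq k l) (h0 : 0 < l 0) (hk1 : ∀ n, 1 ≤ k n) {j n : ℕ}
    (hk : k (n + 2 * j) ≠ 1) : 0 < l n - l (n + 1) := by
  induction j generalizing n with
  | zero =>
    have h1 : (2 : ℝ) ≤ k n := by
      have := hk1 n
      have h2 : k n ≠ 1 := hk
      exact_mod_cast (by omega : 2 ≤ k n)
    have h2 := h.gap_nonneg (n + 2)
    have h3 := h.pos h0 (n + 1)
    rw [h.gap_eq]
    change 0 ≤ l (n + 2) - l (n + 3) at h2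
    nlinarith
  | succ j ih =>
    have h1 : (1 : ℝ) ≤ k n := by exact_mod_cast hk1 n
    have h2 : 0 < l (n + 2) - l (n + 3) :=
      ih (by rwa [show n + 2 + 2 * j = n + 2 * (j + 1) by ring])
    have h3 := h.nonneg (n + 1)
    rw [h.gap_eq]
    nlinarith

/-- Along a block of `2q` letters `1` the gaps alternate between two values. -/
lemma block (h : IsLengthSeq k l) (n q : ℕ) (hk : ∀ i < 2 * q, k (n + i) = 1) :
    l n - l (n + 1) = l (n + 2 * q) - l (n + 2 * q + 1) ∧
    l (n + 1) - l (n + 2) = l (n + 2 * q + 1) - l (n + 2 * q + 2) ∧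
    l n = l (n + 2 * q) + q * ((l n - l (n + 1)) + (l (n + 1) - l (n + 2))) := by
  induction q with
  | zero => simp
  | succ q ih =>
    obtain ⟨h1, h2, h3⟩ := ih fun i hi => hk i (by omega)
    have h4 := h.gap_eq (n + 2 * q)
    have h5 := h.gap_eq (n + 2 * q + 1)
    rw [hk _ (by omega), Nat.cast_one, sub_self, zero_mul, zero_add] at h4
    rw [add_assoc n, hk _ (by omega), Nat.cast_one, sub_self, zero_mul, zero_add] at h5
    simp only [← add_assoc] at h5
    rw [show n + 2 * (q + 1) = n + 2 * q + 2 by ring]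
    refine ⟨h1.trans h4, h2.trans h5, ?_⟩
    push_cast
    linear_combination h3 - h1 - h2

end IsLengthSeq

lemma mem_codeSet_iff {k : ℕ → ℕ} :
    k ∈ codeSet ↔ (∀ i, 1 ≤ k i) ∧ ∀ n, ∃ j, k (n + 2 * j) ≠ 1 := by
  simp only [codeSet, Set.mem_ofPred_eq, frequently_atTop]
  refine and_congr_right fun _ => ⟨fun h n => ?_, fun h => ⟨fun a => ?_, fun a => ?_⟩⟩
  · obtain ⟨c, rfl | rfl⟩ := Nat.even_or_odd' n
    · obtain ⟨b, hb, h1⟩ := h.1 c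
      exact ⟨b - c, by rwa [show 2 * c + 2 * (b - c) = 2 * b by omega]⟩
    · obtain ⟨b, hb, h1⟩ := h.2 c
      exact ⟨b - c, by rwa [show 2 * c + 1 + 2 * (b - c) = 2 * b + 1 by omega]⟩
  · obtain ⟨j, hj⟩ := h (2 * a)
    exact ⟨a + j, by omega, by rwa [show 2 * (a + j) = 2 * a + 2 * j by ring]⟩
  · obtain ⟨j, hj⟩ := h (2 * a + 1)
    exact ⟨a + j, by omega, by rwa [show 2 * (a + j) + 1 = 2 * a + 1 + 2 * j by ring]⟩

lemma code_mem_codeSet {p : ℝ × ℝ} (hp : p ∈ paramSet) : code p ∈ codeSet :=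
  mem_codeSet_iff.2 ⟨one_le_code hp, fun n =>
    (isLengthSeq_baseLength hp).exists_ne_one (sub_pos.2 (baseLength_succ_lt hp n))⟩

lemma fst_le_inv_code {p : ℝ × ℝ} (hp : p ∈ paramSet) (n : ℕ) :
    (code p n : ℝ) * (gauss^[n] p).1 ≤ 1 := by
  have h := hp n
  have h0 := h.1.trans h.2.1
  rw [← le_div_iff₀ h0]
  exact Nat.floor_le (by positivity)

lemma tendsto_baseLength {p : ℝ × ℝ} (hp : p ∈ paramSet) :
    Tendsto (baseLength p) atTop (𝓝 0) := by
  have hl := isLengthSeq_baseLength hp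
  have hb : BddBelow (Set.range (baseLength p)) :=
    ⟨0, by rintro _ ⟨n, rfl⟩; exact (baseLength_pos hp n).le⟩
  have ht := tendsto_atTop_ciInf hl.antitone hb
  set L := ⨅ n, baseLength p n with hL
  have hL0 : 0 ≤ L := ge_of_tendsto' ht fun n => (baseLength_pos hp n).le
  have hfr : ∃ᶠ n in atTop, baseLength p (n + 1) ≤ baseLength p n / 2 := by
    rw [frequently_atTop]
    intro a
    obtain ⟨j, hj⟩ := (mem_codeSet_iff.1 (code_mem_codeSet hp)).2 a
    refine ⟨a + 2 * j, by omega, ?_⟩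
    have h1 : (2 : ℝ) ≤ code p (a + 2 * j) := by
      have := one_le_code hp (a + 2 * j)
      exact_mod_cast (by omega : 2 ≤ code p (a + 2 * j))
    have h2 := fst_le_inv_code hp (a + 2 * j)
    have h3 := hp (a + 2 * j)
    have h4 := h3.1.trans h3.2.1
    have h5 : (gauss^[a + 2 * j] p).1 ≤ 1 / 2 := by nlinarith
    rw [baseLength_succ]
    have := baseLength_pos hp (a + 2 * j)
    nlinarith
  have h1 := (tendsto_add_atTop_iff_nat 1).2 ht
  have h2 : L ≤ L / 2 := le_of_tendsto_of_tendsto_of_frequently h1 (ht.div_const 2) hfr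
  have h3 : L = 0 := by linarith
  rwa [h3] at ht
/-! ### Uniqueness of the parameters with a given code -/

/-- Nonnegativity of the coordinates `d_a, d_{a+1}, ℓ_{a+2}` of a solution of the recurrence
propagates from stage `a` to all earlier stages. -/
lemma gaps_nonneg_of_le {k : ℕ → ℕ} (hk : ∀ n, 1 ≤ k n) {e : ℕ → ℝ}
    (he : ∀ n, e n = k n * e (n + 1) + e (n + 2) - e (n + 3)) {n a : ℕ} (ha : n ≤ a)
    (h : 0 ≤ e a - e (a + 1) ∧ 0 ≤ e (a + 1) - e (a + 2) ∧ 0 ≤ e (a + 2)) :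
    0 ≤ e n - e (n + 1) ∧ 0 ≤ e (n + 1) - e (n + 2) ∧ 0 ≤ e (n + 2) := by
  induction ha using Nat.decreasingInduction with
  | self => exact h
  | of_succ j hj ih =>
    obtain ⟨h1, h2, h3⟩ := ih
    have h4 : (1 : ℝ) ≤ k j := by exact_mod_cast hk j
    have h5 := he j
    simp only [add_assoc, Nat.reduceAdd] at h1 h2 h3
    have h6 : 0 ≤ e (j + 1) := by linarith
    exact ⟨by nlinarith, h1, by linarith⟩

lemma isLengthSeq_of_frequently {k : ℕ → ℕ} (hk : ∀ n, 1 ≤ k n) {e : ℕ → ℝ}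
    (he : ∀ n, e n = k n * e (n + 1) + e (n + 2) - e (n + 3))
    (hf : ∀ M, ∃ a ≥ M, 0 ≤ e a - e (a + 1) ∧ 0 ≤ e (a + 1) - e (a + 2) ∧ 0 ≤ e (a + 2)) :
    IsLengthSeq k e := by
  have key : ∀ n, 0 ≤ e n - e (n + 1) ∧ 0 ≤ e (n + 1) - e (n + 2) ∧ 0 ≤ e (n + 2) := fun n =>
    let ⟨_, ha, h⟩ := hf n
    gaps_nonneg_of_le hk he ha h
  refine ⟨fun n => ?_, fun n => sub_nonneg.1 (key n).1, he⟩
  obtain ⟨h1, h2, h3⟩ := key n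
  linarith

/-- Arbitrarily late there are letters `k_a, k_b ≠ 1` of opposite parity with only letters `1` in
between. -/
lemma exists_block {k : ℕ → ℕ} (hk : k ∈ codeSet) (M : ℕ) :
    ∃ a q, M ≤ a ∧ k a ≠ 1 ∧ k (a + 1 + 2 * q) ≠ 1 ∧ ∀ i < 2 * q, k (a + 1 + i) = 1 := by
  classical
  obtain ⟨-, hk⟩ := mem_codeSet_iff.1 hk
  obtain ⟨j, hj⟩ := hk M
  -- `b = M + 2 * j + 1 + 2 * r` is the first letter `≠ 1` of the other parity after `M + 2 * j`,
  -- and `a = M + 2 * j + 2 * t` is the last one of the parity of `M` before it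
  have hr := hk (M + 2 * j + 1)
  set r := Nat.find hr with hrdef
  set t := Nat.findGreatest (fun t => k (M + 2 * j + 2 * t) ≠ 1) r with htdef
  have ht : k (M + 2 * j + 2 * t) ≠ 1 :=
    Nat.findGreatest_spec (P := fun t => k (M + 2 * j + 2 * t) ≠ 1) (Nat.zero_le r) (by simpa)
  have htr : t ≤ r := Nat.findGreatest_le r
  refine ⟨M + 2 * j + 2 * t, r - t, by omega, ht, ?_, fun i hi => ?_⟩
  · have := Nat.find_spec hr
    rwa [show M + 2 * j + 2 * t + 1 + 2 * (r - t) = M + 2 * j + 1 + 2 * r by omega]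
  · obtain ⟨c, rfl | rfl⟩ := Nat.even_or_odd' i
    · have := Nat.find_min hr (m := t + c) (by omega)
      rw [not_not] at this
      rwa [show M + 2 * j + 2 * t + 1 + 2 * c = M + 2 * j + 1 + 2 * (t + c) by ring]
    · have := Nat.findGreatest_is_greatest (P := fun t => k (M + 2 * j + 2 * t) ≠ 1)
        (n := r) (k := t + c + 1) (by omega) (by omega)
      rw [not_not] at this
      rwa [show M + 2 * j + 2 * t + 1 + (2 * c + 1) = M + 2 * j + 2 * (t + c + 1) by ring]

/-- At infinitely many stages `a` the direction of the vector `(d_a, d_{a+1}, ℓ_{a+2})` is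
determined by `k` up to a factor `6`, uniformly over all solutions. -/
lemma exists_uniform_stage {k : ℕ → ℕ} (hk : k ∈ codeSet) (M : ℕ) :
    ∃ a ≥ M, ∃ b : ℕ, ∃ c₀ c₁ c₂ : ℝ, 0 ≤ c₀ ∧ 0 ≤ c₁ ∧ 0 ≤ c₂ ∧ ∀ l, IsLengthSeq k l →
      (c₀ * l b ≤ l a - l (a + 1) ∧ l a - l (a + 1) ≤ 6 * c₀ * l b) ∧
      (c₁ * l b ≤ l (a + 1) - l (a + 2) ∧ l (a + 1) - l (a + 2) ≤ 6 * c₁ * l b) ∧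
      (c₂ * l b ≤ l (a + 2) ∧ l (a + 2) ≤ 6 * c₂ * l b) := by
  obtain ⟨a, q, ha, hka, hkb, hki⟩ := exists_block hk M
  have h2 : ∀ i, k i ≠ 1 → (1 : ℝ) ≤ (k i : ℝ) - 1 := fun i hi => by
    have h1 := hk.1 i
    have : (2 : ℝ) ≤ k i := by exact_mod_cast (by omega : 2 ≤ k i)
    linarith
  have hA := h2 _ hka
  have hB := h2 _ hkb
  set A : ℝ := (k a : ℝ) - 1
  set B : ℝ := (k (a + 1 + 2 * q) : ℝ) - 1
  have hq : (0 : ℝ) ≤ q := Nat.cast_nonneg q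
  have hqB : (q : ℝ) ≤ q * B := le_mul_of_one_le_right hq hB
  refine ⟨a, ha, a + 1 + 2 * q + 1, A * ((q + 1) * B + 1), B, q * B + 1, by positivity,
    by positivity, by positivity, fun l hl => ?_⟩
  obtain ⟨e1, e2, e3⟩ := hl.block (a + 1) q hki
  have g1 := hl.gap_eq a
  have g2 := hl.gap_eq (a + 1 + 2 * q)
  have n1 := hl.gap_nonneg (a + 2)
  have n2 := hl.gap_nonneg (a + 1 + 2 * q + 2)
  have n3 := hl.gap_nonneg (a + 1 + 2 * q + 1)
  have u3 := hl.nonneg (a + 1 + 2 * q + 2)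
  have u4 := hl.nonneg (a + 1 + 2 * q + 3)
  have v3 := hl.nonneg (a + 3)
  have p1 : a + 1 + 1 = a + 2 := rfl
  have p2 : a + 1 + 2 = a + 3 := rfl
  have p3 : a + 2 + 1 = a + 3 := rfl
  have p4 : a + 1 + 2 * q + 2 + 1 = a + 1 + 2 * q + 3 := rfl
  have p5 : a + 1 + 2 * q + 1 + 1 = a + 1 + 2 * q + 2 := rfl
  have u1 := hl.nonneg (a + 1 + 2 * q + 1)
  rw [p1, p2] at *
  rw [p3] at n1
  rw [p4] at n2
  rw [p5] at n3
  change l a - l (a + 1) = A * l (a + 1) + _ at g1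
  change _ = B * l (a + 1 + 2 * q + 1) + _ at g2
  set s := l (a + 1 + 2 * q + 1) with hs
  set D := l (a + 1) - l (a + 2) with hD
  set D' := l (a + 2) - l (a + 3) with hD'
  have hD's : D' ≤ s := by linarith
  have hDl : B * s ≤ D := by linarith
  have hDu : D ≤ B * s + s := by linarith
  have hsB : s ≤ B * s := le_mul_of_one_le_left u1 hB
  have q1 : q * (B * s) ≤ q * D := mul_le_mul_of_nonneg_left hDl hq
  have q2 : q * D ≤ q * (B * s + s) := mul_le_mul_of_nonneg_left hDu hq
  have q3 : q * D' ≤ q * s := mul_le_mul_of_nonneg_left hD's hq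
  have q4 : 0 ≤ q * D' := mul_nonneg hq n1
  have q5 : q * s ≤ q * (B * s) := mul_le_mul_of_nonneg_left hsB hq
  have q0 : 0 ≤ q * s := mul_nonneg hq u1
  have hl2 : l (a + 2) = s + q * (D + D') := by linarith
  have lo : ((q + 1) * B + 1) * s ≤ l (a + 1) := by linarith
  have up : l (a + 1) ≤ 3 * (((q + 1) * B + 1) * s) := by linarith
  have a1 := mul_le_mul_of_nonneg_left lo (zero_le_one.trans hA)
  have a2 := mul_le_mul_of_nonneg_left up (zero_le_one.trans hA)
  have a3 : l (a + 1) ≤ A * l (a + 1) := le_mul_of_one_le_left (by linarith) hA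
  refine ⟨⟨by linarith, by linarith⟩, ⟨by linarith, by linarith⟩, by linarith, by linarith⟩

namespace IsLengthSeq

variable {k : ℕ → ℕ} {l m : ℕ → ℝ}

lemma eq_sub_smul (hl : IsLengthSeq k l) (hm : IsLengthSeq k m) (t : ℝ) (n : ℕ) :
    l n - t * m n = k n * (l (n + 1) - t * m (n + 1)) + (l (n + 2) - t * m (n + 2)) -
      (l (n + 3) - t * m (n + 3)) := by
  linear_combination hl.eq n - t * hm.eq n

/-- Two solutions are comparable: at a uniform stage the coordinates of both agree up to a factor
`6` with multiples of one fixed vector, and the initial values bound the ratio of the multiples. -/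
lemma sub_smul (hk : k ∈ codeSet) (hl : IsLengthSeq k l) (hm : IsLengthSeq k m) (hm0 : m 0 = 1) :
    IsLengthSeq k fun n => l n - l 0 / 36 * m n := by
  refine isLengthSeq_of_frequently hk.1 (hl.eq_sub_smul hm _) fun M => ?_
  obtain ⟨a, ha, b, c₀, c₁, c₂, h₀, h₁, h₂, h⟩ := exists_uniform_stage hk M
  obtain ⟨⟨l1, l2⟩, ⟨l3, l4⟩, l5, l6⟩ := h l hl
  obtain ⟨⟨m1, m2⟩, ⟨m3, m4⟩, m5, m6⟩ := h m hm
  have hlb := hl.nonneg b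
  have hmb := hm.nonneg b
  have hl0 := hl.nonneg 0
  have key : l 0 * m b ≤ 6 * l b := by
    -- the coordinates of `6 * l b * m - m b * l` are nonnegative at stage `a`, hence at stage `0`
    obtain ⟨h1, h2, h3⟩ := gaps_nonneg_of_le (e := fun n => 6 * l b * m n - m b * l n) hk.1
      (fun n => by linear_combination 6 * l b * hm.eq n - m b * hl.eq n) (Nat.zero_le a)
      ⟨by nlinarith, by nlinarith, by nlinarith⟩
    simp only [zero_add, hm0] at h1 h2 h3
    linarith
  refine ⟨a, ha, ?_, ?_, ?_⟩
  · have := mul_le_mul_of_nonneg_left key h₀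
    nlinarith
  · have := mul_le_mul_of_nonneg_left key h₁
    nlinarith
  · have := mul_le_mul_of_nonneg_left key h₂
    nlinarith

/-- Subtracting repeatedly the fixed proportion allowed by `IsLengthSeq.sub_smul` exhausts `l`. -/
lemma le_of_normalized (hk : k ∈ codeSet) (hl : IsLengthSeq k l) (hm : IsLengthSeq k m)
    (hl0 : l 0 = 1) (hm0 : m 0 = 1) (n : ℕ) : m n ≤ l n := by
  have key : ∀ i : ℕ, IsLengthSeq k fun n => l n - (1 - (35 / 36 : ℝ) ^ i) * m n := by
    intro i
    induction i with
    | zero => simpa using hl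
    | succ i ih =>
      have := ih.sub_smul hk hm hm0
      convert this using 2 with n
      simp only [hl0, hm0]
      ring
  have ht : Tendsto (fun i : ℕ => l n - (1 - (35 / 36 : ℝ) ^ i) * m n) atTop
      (𝓝 (l n - (1 - 0) * m n)) :=
    ((tendsto_pow_atTop_nhds_zero_of_lt_one (by norm_num) (by norm_num)).const_sub 1
      |>.mul_const _).const_sub _
  have := ge_of_tendsto' ht fun i => (key i).nonneg n
  linarith

end IsLengthSeq

lemma injOn_code : Set.InjOn code paramSet := by
  intro p hp q hq h
  have hl := isLengthSeq_baseLength hp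
  have hm := isLengthSeq_baseLength hq
  rw [← h] at hm
  have hk := code_mem_codeSet hp
  have key : ∀ n, baseLength p n = baseLength q n := fun n =>
    le_antisymm (hm.le_of_normalized hk hl (by simp) (by simp) n)
      (hl.le_of_normalized hk hm (by simp) (by simp) n)
  have e : ∀ r ∈ paramSet, r = (baseLength r 1, baseLength r 2) := fun r hr => by
    ext
    · simp [baseLength_succ]
    · simp [baseLength_add_two hr 0]
  rw [e p hp, e q hq, key, key]

/-! ### Existence of a parameter with a given code -/

/-- The sequences in `[0, 1]` satisfying the first `N` of the equations
`1 / α_n = k_n + α_{n+1} (1 - α_{n+2})`, which relate the first coordinates along a `G`-orbit. -/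
def approxSeq (k : ℕ → ℕ) (N : ℕ) : Set (ℕ → ℝ) :=
  {x | (∀ n, x n ∈ Set.Icc (0 : ℝ) 1) ∧ ∀ n < N, x n * (k n + x (n + 1) * (1 - x (n + 2))) = 1}

lemma approxSeq_nonempty {k : ℕ → ℕ} (hk : ∀ n, 1 ≤ k n) (N : ℕ) : (approxSeq k N).Nonempty := by
  induction N generalizing k with
  | zero => exact ⟨fun _ => 0, fun n => by simp, by simp⟩
  | succ N ih =>
    obtain ⟨y, hy, hy'⟩ := ih (k := fun n => k (n + 1)) fun n => hk _
    have h1 : (1 : ℝ) ≤ k 0 := by exact_mod_cast hk 0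
    have h2 : 0 ≤ y 0 * (1 - y 1) := mul_nonneg (hy 0).1 (sub_nonneg.2 (hy 1).2)
    have h3 : 0 < k 0 + y 0 * (1 - y 1) := by linarith
    refine ⟨fun n => Nat.casesOn n (k 0 + y 0 * (1 - y 1))⁻¹ y, ?_, ?_⟩
    · rintro (_ | n)
      · exact ⟨inv_nonneg.2 h3.le, inv_le_one_of_one_le₀ (by linarith)⟩
      · exact hy n
    · rintro (_ | n) hn
      · exact inv_mul_cancel₀ h3.ne'
      · exact hy' n (by omega)

lemma isCompact_approxSeq (k : ℕ → ℕ) (N : ℕ) : IsCompact (approxSeq k N) := by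
  have h : approxSeq k N = (Set.univ.pi fun _ : ℕ => Set.Icc (0 : ℝ) 1) ∩
      ⋂ n, ⋂ _ : n < N, {x : ℕ → ℝ | x n * (k n + x (n + 1) * (1 - x (n + 2))) = 1} := by
    ext x
    simp only [approxSeq, Set.mem_inter_iff, Set.mem_univ_pi, Set.mem_iInter]
    rfl
  rw [h]
  refine (isCompact_univ_pi fun _ => isCompact_Icc).inter_right
    (isClosed_iInter fun n => isClosed_iInter fun _ => isClosed_eq ?_ continuous_const)
  fun_prop

lemma exists_seq {k : ℕ → ℕ} (hk : ∀ n, 1 ≤ k n) : ∃ x : ℕ → ℝ, (∀ n, x n ∈ Set.Icc (0 : ℝ) 1) ∧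
    ∀ n, x n * (k n + x (n + 1) * (1 - x (n + 2))) = 1 := by
  obtain ⟨x, hx⟩ := IsCompact.nonempty_iInter_of_sequence_nonempty_isCompact_isClosed (approxSeq k)
    (fun N x hx => ⟨hx.1, fun n hn => hx.2 n (hn.trans N.lt_succ_self)⟩) (approxSeq_nonempty hk)
    (isCompact_approxSeq k 0) fun N => (isCompact_approxSeq k N).isClosed
  rw [Set.mem_iInter] at hx
  exact ⟨x, (hx 0).1, fun n => (hx (n + 1)).2 n n.lt_succ_self⟩

lemma surjOn_code : Set.SurjOn code paramSet codeSet := by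
  intro k hk
  obtain ⟨hk1, hk2⟩ := mem_codeSet_iff.1 hk
  obtain ⟨x, hx, he⟩ := exists_seq hk1
  have hpos : ∀ n, 0 < x n := fun n =>
    (hx n).1.lt_of_ne fun h => by have := he n; rw [← h, zero_mul] at this; exact zero_ne_one this
  -- the products of the `x n` solve the linear recurrence, which forces `x n < 1`
  set l : ℕ → ℝ := fun n => ∏ i ∈ Finset.range n, x i with hl
  have hs : ∀ n, l (n + 1) = l n * x n := fun n => Finset.prod_range_succ _ _
  have hlpos : ∀ n, 0 < l n := fun n => Finset.prod_pos fun i _ => hpos i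
  have hlen : IsLengthSeq k l := by
    refine ⟨fun n => (hlpos n).le, fun n => ?_, fun n => ?_⟩
    · rw [hs]; exact mul_le_of_le_one_right (hlpos n).le (hx n).2
    · rw [hs (n + 2), hs (n + 1), hs n]
      linear_combination (-l n) * he n
  have hlt : ∀ n, x n < 1 := fun n => by
    obtain ⟨j, hj⟩ := hk2 n
    have h := hlen.gap_pos (hlpos 0) hk1 hj
    rw [hs] at h
    have := hlpos n
    nlinarith
  have hfl : ∀ n, 1 / x n = k n + x (n + 1) * (1 - x (n + 2)) := fun n => by
    rw [div_eq_iff (hpos n).ne', mul_comm]; exact (he n).symm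
  have hin : ∀ n, 0 ≤ x (n + 1) * (1 - x (n + 2)) ∧ x (n + 1) * (1 - x (n + 2)) < 1 := fun n => by
    have h1 := hpos (n + 1); have h2 := hlt (n + 1); have h3 := hpos (n + 2); have h4 := hlt (n + 2)
    exact ⟨by nlinarith, by nlinarith⟩
  have horb : ∀ n, gauss^[n] (x 0, x 0 * x 1) = (x n, x n * x (n + 1)) := by
    intro n
    induction n with
    | zero => rfl
    | succ n ih =>
      have hfloor : ⌊1 / x n⌋ = (k n : ℤ) := by
        rw [Int.floor_eq_iff, hfl]
        have := hin n
        push_cast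
        exact ⟨by linarith, by linarith⟩
      have h0 := (hpos n).ne'
      rw [Function.iterate_succ_apply', ih]
      simp only [gauss, hfloor, Prod.mk.injEq]
      refine ⟨by field_simp, ?_⟩
      have := hfl n
      push_cast
      rw [sub_div, this]
      field_simp
      ring
  refine ⟨(x 0, x 0 * x 1), fun n => ?_, funext fun n => ?_⟩
  · rw [horb]
    exact ⟨mul_pos (hpos n) (hpos _), mul_lt_of_lt_one_right (hpos n) (hlt _), hlt n⟩
  · simp only [code, horb]
    rw [Nat.floor_eq_iff (by have := hpos n; positivity), hfl]
    have := hin n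
    exact ⟨by linarith, by linarith⟩

lemma bijOn_code : Set.BijOn code paramSet codeSet :=
  ⟨fun _ hp => code_mem_codeSet hp, injOn_code, surjOn_code⟩

lemma not_countable_codeSet : ¬ codeSet.Countable := by
  intro h
  let f : Set ℕ → codeSet := fun s => ⟨fun i => open Classical in if i ∈ s then 2 else 3, by
    rw [mem_codeSet_iff]
    refine ⟨fun i => ?_, fun n => ⟨0, ?_⟩⟩ <;> split_ifs <;> norm_num⟩
  have hf : Function.Injective f := by
    intro s t hst
    ext i
    have h1 := congrFun (congrArg Subtype.val hst) i
    by_cases hs : i ∈ s <;> by_cases ht : i ∈ t <;> simp_all [f]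
  have : Countable codeSet := h
  have := hf.countable
  obtain ⟨g, hg⟩ := exists_injective_nat (Set ℕ)
  exact Function.cantor_injective g hg

lemma not_countable_paramSet : ¬ paramSet.Countable := fun h =>
  not_countable_codeSet (bijOn_code.image_eq ▸ h.image code)
/-! ### The first return map to `[1 - α, 1)` and its iterates -/

lemma branch_eq_zero {p : ℝ × ℝ} {x : ℝ} (h : x < 1 - p.1) : branch p x = 0 := if_pos h

lemma branch_eq_one {p : ℝ × ℝ} {x : ℝ} (h : 1 - p.1 ≤ x) (h' : x < 1 - p.2) :
    branch p x = 1 := by rw [branch, if_neg h.not_gt, if_pos h']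

lemma branch_eq_two {p : ℝ × ℝ} (hp : p ∈ triangle) {x : ℝ} (h : 1 - p.2 ≤ x) :
    branch p x = 2 := by
  have := hp.2.1
  rw [branch, if_neg (by linarith), if_neg h.not_gt]

lemma itm_of_lt {p : ℝ × ℝ} {x : ℝ} (h : x < 1 - p.1) : itm p x = x + p.1 := by
  rw [itm, branch_eq_zero h]; rfl

lemma itm_of_mem {p : ℝ × ℝ} {x : ℝ} (h : 1 - p.1 ≤ x) (h' : x < 1 - p.2) :
    itm p x = x + p.2 := by
  rw [itm, branch_eq_one h h']; rfl

lemma itm_of_le {p : ℝ × ℝ} (hp : p ∈ triangle) {x : ℝ} (h : 1 - p.2 ≤ x) :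
    itm p x = x + (p.2 - 1) := by
  rw [itm, branch_eq_two hp h]; rfl

lemma itm_mem {p : ℝ × ℝ} (hp : p ∈ triangle) {x : ℝ} (hx : x ∈ Set.Ico (0 : ℝ) 1) :
    itm p x ∈ Set.Ico (0 : ℝ) 1 := by
  obtain ⟨h1, h2, h3⟩ := hp
  obtain ⟨h4, h5⟩ := hx
  rcases lt_or_ge x (1 - p.1) with h | h
  · rw [itm_of_lt h]; constructor <;> linarith
  rcases lt_or_ge x (1 - p.2) with h' | h'
  · rw [itm_of_mem h h']; constructor <;> linarith
  · rw [itm_of_le ⟨h1, h2, h3⟩ h']; constructor <;> linarith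

lemma iterate_itm_mem {p : ℝ × ℝ} (hp : p ∈ triangle) {x : ℝ} (hx : x ∈ Set.Ico (0 : ℝ) 1)
    (n : ℕ) : (itm p)^[n] x ∈ Set.Ico (0 : ℝ) 1 :=
  Set.MapsTo.iterate (fun _ h => itm_mem hp h) n hx

/-- The itinerary of `x` under the right-continuous map `itm p`. -/
noncomputable def rightItin (p : ℝ × ℝ) (x : ℝ) (i : ℕ) : Fin 3 := branch p ((itm p)^[i] x)

lemma rightItin_iterate (p : ℝ × ℝ) (x : ℝ) (m i : ℕ) :
    rightItin p ((itm p)^[m] x) i = rightItin p x (i + m) := by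
  simp only [rightItin, Function.iterate_add_apply]

/-- The first `n` letters of the itinerary of `x`. -/
noncomputable def itinWord (p : ℝ × ℝ) (x : ℝ) (n : ℕ) : List (Fin 3) :=
  (List.range n).map (rightItin p x)

@[simp] lemma length_itinWord (p : ℝ × ℝ) (x : ℝ) (n : ℕ) : (itinWord p x n).length = n := by
  simp [itinWord]

lemma itinWord_add (p : ℝ × ℝ) (x : ℝ) (m n : ℕ) :
    itinWord p x (m + n) = itinWord p x m ++ itinWord p ((itm p)^[m] x) n := by
  simp only [itinWord, List.range_add, List.map_append, List.map_map]
  congr 1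
  refine List.map_congr_left fun i _ => ?_
  rw [Function.comp_apply, rightItin_iterate, add_comm]

lemma itinWord_one (p : ℝ × ℝ) (x : ℝ) : itinWord p x 1 = [branch p x] := rfl

lemma itinWord_succ (p : ℝ × ℝ) (x : ℝ) (n : ℕ) :
    itinWord p x (n + 1) = branch p x :: itinWord p (itm p x) n := by
  rw [add_comm, itinWord_add]; rfl

lemma getElem?_itinWord (p : ℝ × ℝ) (x : ℝ) {n i : ℕ} (h : i < n) :
    (itinWord p x n)[i]? = some (rightItin p x i) := by
  simp [itinWord, h]

/-- The orbit climbs by `α` as long as it stays below `1 - α`. -/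
lemma itinWord_climb {p : ℝ × ℝ} (hp : p ∈ triangle) (m : ℕ) {z : ℝ} (h : z + m * p.1 < 1) :
    itinWord p z m = List.replicate m 0 ∧ (itm p)^[m] z = z + m * p.1 := by
  induction m generalizing z with
  | zero => simp [itinWord]
  | succ m ih =>
    have h0 : 0 < p.1 := hp.1.trans hp.2.1
    have h1 : (0 : ℝ) ≤ m * p.1 := by positivity
    push_cast at h
    have h2 : z < 1 - p.1 := by linarith
    obtain ⟨h3, h4⟩ := ih (z := z + p.1) (by linarith)
    rw [itinWord_succ, branch_eq_zero h2, itm_of_lt h2, h3, Function.iterate_succ_apply,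
      itm_of_lt h2, h4]
    refine ⟨rfl, ?_⟩
    push_cast
    ring

/-- The affine map of `[0, 1)` onto the domain `[1 - α, 1)` of the first return map. -/
def baseMap (p : ℝ × ℝ) (y : ℝ) : ℝ := 1 - p.1 + p.1 * y

lemma baseMap_mem {p : ℝ × ℝ} (hp : p ∈ triangle) {y : ℝ} (hy : y ∈ Set.Ico (0 : ℝ) 1) :
    baseMap p y ∈ Set.Ico (0 : ℝ) 1 := by
  obtain ⟨h1, h2, h3⟩ := hp
  obtain ⟨h4, h5⟩ := hy
  simp only [baseMap]
  constructor <;> nlinarith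

/-- `baseMap p` conjugates the map with parameter `gauss p` to the first return map of `itm p`,
and the itinerary up to the return is given by the substitution `χ_k`. -/
lemma itinWord_baseMap_one {p : ℝ × ℝ} (hp : p ∈ paramSet) {y : ℝ} (hy : y ∈ Set.Ico (0 : ℝ) 1) :
    itinWord p (baseMap p y) (chi (code p 0) (branch (gauss p) y)).length =
      chi (code p 0) (branch (gauss p) y) ∧
    (itm p)^[(chi (code p 0) (branch (gauss p) y)).length] (baseMap p y) =
      baseMap p (itm (gauss p) y) := by
  have ht := mem_triangle hp
  obtain ⟨h1, h2, h3⟩ := mem_triangle hp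
  obtain ⟨h1', h2', h3'⟩ := mem_triangle (gauss_mem hp)
  have e1 := fst_mul_gauss_fst ht
  have e2 := fst_mul_gauss_snd ht
  have hk := one_le_code hp 0
  set k := code p 0
  set a := (gauss p).1
  set b := (gauss p).2
  obtain ⟨hy0, hy1⟩ := hy
  have h0 : 0 < p.1 := h1.trans h2
  have hlow : 1 - p.1 ≤ baseMap p y := by simp only [baseMap]; nlinarith
  rcases lt_or_ge y (1 - a) with h | h
  · have hup : baseMap p y < 1 - p.2 := by simp only [baseMap]; nlinarith
    rw [branch_eq_zero h, itm_of_lt h]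
    change itinWord p (baseMap p y) 1 = [1] ∧ itm p (baseMap p y) = _
    rw [itinWord_one, branch_eq_one hlow hup, itm_of_mem hlow hup]
    refine ⟨rfl, ?_⟩
    simp only [baseMap]
    linear_combination -e1
  have hup : 1 - p.2 ≤ baseMap p y := by simp only [baseMap]; nlinarith
  have hT := itm_of_le ht hup
  -- the orbit drops below `1 - α` and then climbs `j` times
  have climb : ∀ j : ℕ, baseMap p y + (p.2 - 1) + j * p.1 < 1 →
      itinWord p (baseMap p y) (j + 1) = 2 :: List.replicate j 0 ∧
      (itm p)^[j + 1] (baseMap p y) = baseMap p y + (p.2 - 1) + j * p.1 := by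
    intro j hj
    obtain ⟨c1, c2⟩ := itinWord_climb ht j hj
    rw [itinWord_succ, branch_eq_two ht hup, Function.iterate_succ_apply, hT, c1, c2]
    exact ⟨rfl, rfl⟩
  rcases lt_or_ge y (1 - b) with h' | h'
  · rw [branch_eq_one h h', itm_of_mem h h']
    have hc := climb k (by simp only [baseMap]; nlinarith)
    have e : chi k 1 = 2 :: List.replicate k 0 := rfl
    rw [e, List.length_cons, List.length_replicate]
    refine ⟨hc.1, hc.2.trans ?_⟩
    simp only [baseMap]
    linear_combination -e2
  · rw [branch_eq_two (mem_triangle (gauss_mem hp)) h',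
      itm_of_le (mem_triangle (gauss_mem hp)) h']
    have hc := climb (k - 1) (by simp only [baseMap]; push_cast [hk]; nlinarith)
    have e : chi k 2 = 2 :: List.replicate (k - 1) 0 := rfl
    rw [e, List.length_cons, List.length_replicate]
    refine ⟨hc.1, hc.2.trans ?_⟩
    simp only [baseMap]
    push_cast [hk]
    linear_combination -e2

lemma itinWord_baseMap {p : ℝ × ℝ} (hp : p ∈ paramSet) {y : ℝ} (hy : y ∈ Set.Ico (0 : ℝ) 1)
    (M : ℕ) :
    itinWord p (baseMap p y) ((itinWord (gauss p) y M).flatMap (chi (code p 0))).length =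
      (itinWord (gauss p) y M).flatMap (chi (code p 0)) ∧
    (itm p)^[((itinWord (gauss p) y M).flatMap (chi (code p 0))).length] (baseMap p y) =
      baseMap p ((itm (gauss p))^[M] y) := by
  induction M generalizing y with
  | zero => simp [itinWord]
  | succ M ih =>
    obtain ⟨h1, h2⟩ := itinWord_baseMap_one hp hy
    obtain ⟨h3, h4⟩ := ih (itm_mem (mem_triangle (gauss_mem hp)) hy)
    rw [itinWord_succ, List.flatMap_cons, List.length_append, itinWord_add, h1, h2, h3,
      add_comm, Function.iterate_add_apply, h2, h4]
    exact ⟨rfl, rfl⟩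

lemma chain_succ' (k : ℕ → ℕ) (n : ℕ) (w : List (Fin 3)) :
    chain k (n + 1) w = (chain (fun i => k (i + 1)) n w).flatMap (chi (k 0)) := by
  induction n generalizing w with
  | zero => rfl
  | succ n ih =>
    change chain k (n + 1) (w.flatMap (chi (k (n + 1)))) = _
    rw [ih]; rfl

/-- The affine map of `[0, 1)` onto the interval `[1 - ℓ_n, 1)`. -/
noncomputable def levelMap (p : ℝ × ℝ) (n : ℕ) (y : ℝ) : ℝ := 1 - baseLength p n * (1 - y)

lemma levelMap_zero (p : ℝ × ℝ) (y : ℝ) : levelMap p 0 y = y := by simp [levelMap]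

lemma levelMap_succ (p : ℝ × ℝ) (n : ℕ) (y : ℝ) :
    levelMap p (n + 1) y = baseMap p (levelMap (gauss p) n y) := by
  simp only [levelMap, baseMap, baseLength_succ']; ring

lemma levelMap_mem {p : ℝ × ℝ} (hp : p ∈ paramSet) (n : ℕ) {y : ℝ} (hy : y ∈ Set.Ico (0 : ℝ) 1) :
    levelMap p n y ∈ Set.Ico (0 : ℝ) 1 := by
  have h1 := baseLength_pos hp n
  have h2 := (isLengthSeq_baseLength hp).antitone (Nat.zero_le n)
  rw [baseLength_zero] at h2
  obtain ⟨h4, h5⟩ := hy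
  simp only [levelMap]
  constructor <;> nlinarith

lemma le_levelMap {p : ℝ × ℝ} (hp : p ∈ paramSet) (n : ℕ) {y : ℝ} (hy : 0 ≤ y) :
    1 - baseLength p n ≤ levelMap p n y := by
  have h1 := baseLength_pos hp n
  simp only [levelMap]
  nlinarith

lemma exists_levelMap_eq {p : ℝ × ℝ} (hp : p ∈ paramSet) (n : ℕ) {x : ℝ}
    (hx : 1 - baseLength p n ≤ x) (hx' : x < 1) :
    ∃ y ∈ Set.Ico (0 : ℝ) 1, levelMap p n y = x := by
  have h1 := baseLength_pos hp n
  refine ⟨1 - (1 - x) / baseLength p n, ⟨?_, ?_⟩, ?_⟩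
  · rw [sub_nonneg, div_le_one h1]; linarith
  · have : 0 < (1 - x) / baseLength p n := div_pos (by linarith) h1
    linarith
  · simp only [levelMap]; field_simp; ring

lemma itinWord_levelMap {p : ℝ × ℝ} (hp : p ∈ paramSet) (n : ℕ) {y : ℝ}
    (hy : y ∈ Set.Ico (0 : ℝ) 1) (M : ℕ) :
    itinWord p (levelMap p n y) (chain (code p) n (itinWord (gauss^[n] p) y M)).length =
      chain (code p) n (itinWord (gauss^[n] p) y M) ∧
    (itm p)^[(chain (code p) n (itinWord (gauss^[n] p) y M)).length] (levelMap p n y) =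
      levelMap p n ((itm (gauss^[n] p))^[M] y) := by
  induction n generalizing p with
  | zero => simp [levelMap_zero, chain]
  | succ n ih =>
    obtain ⟨h1, h2⟩ := ih (gauss_mem hp)
    have hc : code (gauss p) = fun i => code p (i + 1) := funext (code_gauss p)
    rw [levelMap_succ, levelMap_succ, chain_succ', Function.iterate_succ_apply, ← hc]
    obtain ⟨h3, h4⟩ := itinWord_baseMap hp (levelMap_mem (gauss_mem hp) n hy)
      (chain (code (gauss p)) n (itinWord (gauss^[n] (gauss p)) y M)).length
    rw [h1, h2] at h4
    rw [h1] at h3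
    exact ⟨h3, h4⟩

lemma exists_iterate_ge_of_le {p : ℝ × ℝ} (J : ℕ) {x : ℝ} (h : 1 - p.1 ≤ x + J * p.1) :
    ∃ j ≤ J, 1 - p.1 ≤ (itm p)^[j] x := by
  induction J generalizing x with
  | zero => exact ⟨0, le_rfl, by simpa using h⟩
  | succ J ih =>
    rcases lt_or_ge x (1 - p.1) with hx | hx
    · obtain ⟨j, hj, hj'⟩ := ih (x := itm p x) (by
        rw [itm_of_lt hx]; push_cast at h; linarith)
      exact ⟨j + 1, by omega, hj'⟩
    · exact ⟨0, Nat.zero_le _, hx⟩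

lemma length_chi_le (k : ℕ) (a : Fin 3) : (chi k a).length ≤ k + 1 := by
  fin_cases a <;> simp [chi]

lemma length_flatMap_chi_le (k : ℕ) (w : List (Fin 3)) :
    (w.flatMap (chi k)).length ≤ (k + 1) * w.length := by
  induction w with
  | nil => simp
  | cons a w ih =>
    have := length_chi_le k a
    rw [List.flatMap_cons, List.length_append, List.length_cons]
    linarith

/-- Every orbit enters `[1 - ℓ_n, 1)`, within a time that only depends on `n`. -/
lemma exists_entrance {p : ℝ × ℝ} (hp : p ∈ paramSet) (n : ℕ) :
    ∃ R, ∀ x ∈ Set.Ico (0 : ℝ) 1, ∃ j ≤ R, 1 - baseLength p n ≤ (itm p)^[j] x := by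
  induction n generalizing p with
  | zero => exact ⟨0, fun x hx => ⟨0, le_rfl, by simpa using hx.1⟩⟩
  | succ n ih =>
    have ht := mem_triangle hp
    have h0 : 0 < p.1 := ht.1.trans ht.2.1
    obtain ⟨R, hR⟩ := ih (gauss_mem hp)
    obtain ⟨J, hJ⟩ := exists_nat_gt (1 / p.1)
    rw [div_lt_iff₀ h0] at hJ
    refine ⟨(code p 0 + 1) * R + J, fun x hx => ?_⟩
    obtain ⟨j, hj, hj'⟩ := exists_iterate_ge_of_le (p := p) J (x := x) (by linarith [hx.1])
    have hm := iterate_itm_mem ht hx j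
    obtain ⟨y, hy, hyx⟩ := exists_levelMap_eq hp 1 (x := (itm p)^[j] x)
      (by simpa [baseLength_succ] using hj') hm.2
    rw [levelMap_succ, levelMap_zero] at hyx
    obtain ⟨i, hi, hi'⟩ := hR y hy
    have h2 := (itinWord_baseMap hp hy i).2
    refine ⟨((itinWord (gauss p) y i).flatMap (chi (code p 0))).length + j, ?_, ?_⟩
    · have := length_flatMap_chi_le (code p 0) (itinWord (gauss p) y i)
      rw [length_itinWord] at this
      have := Nat.mul_le_mul_left (code p 0 + 1) hi
      omega
    · rw [Function.iterate_add_apply, ← hyx, h2, baseMap, baseLength_succ']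
      nlinarith
/-! ### The attractor and its renormalization -/

lemma attractor_subset (p : ℝ × ℝ) : attractor p ⊆ Set.Ico 0 1 := fun x hx => by
  simpa using Set.mem_iInter.1 hx 0

lemma antitone_image_iterate {p : ℝ × ℝ} (hp : p ∈ triangle) :
    Antitone fun n : ℕ => (itm p)^[n] '' Set.Ico (0 : ℝ) 1 := by
  refine antitone_nat_of_succ_le fun n => ?_
  rintro _ ⟨x, hx, rfl⟩
  exact ⟨itm p x, itm_mem hp hx, rfl⟩

lemma itm_mem_attractor {p : ℝ × ℝ} (hp : p ∈ triangle) {x : ℝ} (hx : x ∈ attractor p) :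
    itm p x ∈ attractor p := by
  refine Set.mem_iInter.2 fun n => antitone_image_iterate hp n.le_succ ?_
  obtain ⟨y, hy, rfl⟩ := Set.mem_iInter.1 hx n
  exact ⟨y, hy, Function.iterate_succ_apply' _ _ _⟩

lemma iterate_itm_mem_attractor {p : ℝ × ℝ} (hp : p ∈ triangle) {x : ℝ} (hx : x ∈ attractor p)
    (n : ℕ) : (itm p)^[n] x ∈ attractor p :=
  Set.MapsTo.iterate (fun _ h => itm_mem_attractor hp h) n hx

/-- `T` maps the attractor onto itself: a point has at most one preimage on each branch, so one
branch serves for all the sets `T^n [0, 1)`. -/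
lemma exists_itm_eq {p : ℝ × ℝ} (hp : p ∈ triangle) {x : ℝ} (hx : x ∈ attractor p) :
    ∃ y ∈ attractor p, itm p y = x := by
  have h : ∀ n : ℕ, ∃ i : Fin 3, x - translation p i ∈ (itm p)^[n] '' Set.Ico (0 : ℝ) 1 ∧
      itm p (x - translation p i) = x := fun n => by
    obtain ⟨z, hz, hzx⟩ := Set.mem_iInter.1 hx (n + 1)
    rw [Function.iterate_succ_apply'] at hzx
    have e : x - translation p (branch p ((itm p)^[n] z)) = (itm p)^[n] z := by
      rw [← hzx, itm]; ring
    exact ⟨branch p ((itm p)^[n] z), by rw [e]; exact ⟨⟨z, hz, rfl⟩, hzx⟩⟩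
  choose i hi hi' using h
  obtain ⟨c, hc⟩ := Finite.exists_infinite_fiber i
  have hinf : ∀ n, ∃ m ≥ n, i m = c := fun n => by
    by_contra! hcon
    exact hc.not_finite ((Set.finite_lt_nat n).subset fun m hm =>
      not_le.1 fun hle => hcon m hle hm)
  obtain ⟨m, -, hm⟩ := hinf 0
  refine ⟨x - translation p c, Set.mem_iInter.2 fun n => ?_, hm ▸ hi' m⟩
  obtain ⟨m', hm', rfl⟩ := hinf n
  exact antitone_image_iterate hp hm' (hi m')

lemma baseMap_mem_image {p : ℝ × ℝ} (hp : p ∈ paramSet) {m : ℕ} {y : ℝ}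
    (hy : y ∈ (itm (gauss p))^[m] '' Set.Ico (0 : ℝ) 1) :
    baseMap p y ∈ (itm p)^[m] '' Set.Ico (0 : ℝ) 1 := by
  obtain ⟨z, hz, rfl⟩ := hy
  rw [← (itinWord_baseMap hp hz m).2]
  refine antitone_image_iterate (mem_triangle hp) ?_
    ⟨_, baseMap_mem (mem_triangle hp) hz, rfl⟩
  -- each letter is substituted by a nonempty word
  have : ∀ w : List (Fin 3), w.length ≤ (w.flatMap (chi (code p 0))).length := fun w => by
    induction w with
    | nil => simp
    | cons a w ih =>
      have : 1 ≤ (chi (code p 0) a).length := by fin_cases a <;> simp [chi]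
      rw [List.flatMap_cons, List.length_append, List.length_cons]
      omega
  simpa using this (itinWord (gauss p) z m)

lemma baseMap_mem_attractor {p : ℝ × ℝ} (hp : p ∈ paramSet) {y : ℝ}
    (hy : y ∈ attractor (gauss p)) : baseMap p y ∈ attractor p :=
  Set.mem_iInter.2 fun m => baseMap_mem_image hp (Set.mem_iInter.1 hy m)

lemma baseMap_baseMap_zero {p : ℝ × ℝ} (hp : p ∈ triangle) :
    baseMap p (baseMap (gauss p) 0) = 1 - p.2 := by
  simp only [baseMap]
  linear_combination -fst_mul_gauss_fst hp

/-- The point `0` is the image of `1 - β`, which is the copy of the point `0` two levels further,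
so it has an infinite backward orbit. -/
lemma zero_mem_attractor {p : ℝ × ℝ} (hp : p ∈ paramSet) : (0 : ℝ) ∈ attractor p := by
  refine Set.mem_iInter.2 fun m => ?_
  induction m generalizing p with
  | zero => exact ⟨0, by simp, rfl⟩
  | succ m ih =>
    have ht := mem_triangle hp
    have h := baseMap_mem_image hp (baseMap_mem_image (gauss_mem hp)
      (ih (gauss_mem (gauss_mem hp))))
    rw [baseMap_baseMap_zero ht] at h
    obtain ⟨z, hz, hz'⟩ := h
    refine ⟨z, hz, ?_⟩
    rw [Function.iterate_succ_apply', hz', itm_of_le ht le_rfl]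
    ring

lemma levelMap_mem_attractor {p : ℝ × ℝ} (hp : p ∈ paramSet) (n : ℕ) {y : ℝ}
    (hy : y ∈ attractor (gauss^[n] p)) : levelMap p n y ∈ attractor p := by
  induction n generalizing p with
  | zero => rwa [levelMap_zero]
  | succ n ih =>
    rw [levelMap_succ]
    exact baseMap_mem_attractor hp (ih (gauss_mem hp) hy)

lemma one_sub_baseLength_mem_attractor {p : ℝ × ℝ} (hp : p ∈ paramSet) (n : ℕ) :
    1 - baseLength p n ∈ attractor p := by
  simpa [levelMap] using levelMap_mem_attractor hp n (zero_mem_attractor (gauss_iterate_mem hp n))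

lemma one_sub_fst_mem_attractor {p : ℝ × ℝ} (hp : p ∈ paramSet) : 1 - p.1 ∈ attractor p := by
  simpa [baseLength_succ] using one_sub_baseLength_mem_attractor hp 1

lemma one_sub_snd_mem_attractor {p : ℝ × ℝ} (hp : p ∈ paramSet) : 1 - p.2 ∈ attractor p := by
  simpa [baseLength_add_two hp 0] using one_sub_baseLength_mem_attractor hp 2

/-- The last visit of a backward orbit in the attractor to `[1 - α, 1)`. -/
lemma exists_last_visit {p : ℝ × ℝ} (hp : p ∈ triangle) {x : ℝ} (hx : x ∈ attractor p) :
    ∃ q ∈ attractor p, 1 - p.1 ≤ q ∧ ((q < 1 - p.2 ∧ x = q + p.2) ∨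
      (1 - p.2 ≤ q ∧ ∃ j : ℕ, x = q + (p.2 - 1) + j * p.1)) := by
  have h0 : 0 < p.1 := hp.1.trans hp.2.1
  obtain ⟨n, hn⟩ := exists_nat_gt (x / p.1)
  rw [div_lt_iff₀ h0] at hn
  induction n generalizing x with
  | zero =>
    have := (attractor_subset p hx).1
    simp only [Nat.cast_zero, zero_mul] at hn
    linarith
  | succ n ih =>
    obtain ⟨y, hy, rfl⟩ := exists_itm_eq hp hx
    rcases lt_or_ge y (1 - p.1) with h | h
    · rw [itm_of_lt h] at hn ⊢
      obtain ⟨q, hq, hq', ⟨h1, h2⟩ | ⟨h1, j, h2⟩⟩ := ih hy (by push_cast at hn; linarith)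
      · have := hp.1; linarith
      · refine ⟨q, hq, hq', Or.inr ⟨h1, j + 1, ?_⟩⟩
        rw [h2]; push_cast; ring
    rcases lt_or_ge y (1 - p.2) with h' | h'
    · exact ⟨y, hy, h, Or.inl ⟨h', itm_of_mem h h'⟩⟩
    · exact ⟨y, hy, h, Or.inr ⟨h', 0, by rw [itm_of_le hp h']; simp⟩⟩

lemma exists_baseMap_eq {p : ℝ × ℝ} (hp : p ∈ paramSet) {x : ℝ} (hx : 1 - p.1 ≤ x) (hx' : x < 1) :
    ∃ y ∈ Set.Ico (0 : ℝ) 1, baseMap p y = x := by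
  simpa only [levelMap_succ, levelMap_zero] using
    exists_levelMap_eq hp 1 (by simpa [baseLength_succ] using hx) hx'

/-- Points whose copy lies in the attractor have a preimage of the same kind, hence an infinite
backward orbit. -/
lemma mem_attractor_gauss {p : ℝ × ℝ} (hp : p ∈ paramSet) {x : ℝ} (hx : x ∈ Set.Ico (0 : ℝ) 1)
    (h : baseMap p x ∈ attractor p) : x ∈ attractor (gauss p) := by
  have ht := mem_triangle hp
  have h0 : 0 < p.1 := ht.1.trans ht.2.1
  have e1 := fst_mul_gauss_fst ht
  have e2 := fst_mul_gauss_snd ht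
  obtain ⟨g1, g2, g3⟩ := mem_triangle (gauss_mem hp)
  have step : ∀ x ∈ Set.Ico (0 : ℝ) 1, baseMap p x ∈ attractor p →
      ∃ y ∈ Set.Ico (0 : ℝ) 1, baseMap p y ∈ attractor p ∧ itm (gauss p) y = x := by
    intro x hx h
    obtain ⟨q, hq, hq1, h2⟩ := exists_last_visit ht h
    obtain ⟨y, hy, rfl⟩ := exists_baseMap_eq hp hq1 (attractor_subset p hq).2
    refine ⟨y, hy, hq, ?_⟩
    simp only [baseMap] at h2
    obtain ⟨h2, h3⟩ | ⟨h2, j, h3⟩ := h2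
    · have h4 : y < 1 - (gauss p).1 := by nlinarith
      rw [itm_of_lt h4]
      refine mul_left_cancel₀ h0.ne' ?_
      linarith
    · have h4 : 1 - (gauss p).1 ≤ y := by nlinarith
      -- the number `j` of climbs is the one that brings the point back to `[1 - α, 1)`
      have h5 : x = y + (gauss p).2 + ((j : ℝ) - code p 0) := by
        refine mul_left_cancel₀ h0.ne' ?_
        linarith
      have hx0 := hx.1
      have hx1 := hx.2
      have hy0 := hy.1
      have hy1 := hy.2
      rcases lt_or_ge y (1 - (gauss p).2) with h' | h'
      · have l1 : (j : ℝ) < code p 0 + 1 := by linarith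
        have l2 : (code p 0 : ℝ) < j + 1 := by linarith
        have l3 : j = code p 0 := by
          have : j < code p 0 + 1 := by exact_mod_cast l1
          have : code p 0 < j + 1 := by exact_mod_cast l2
          omega
        rw [itm_of_mem h4 h', h5, l3]; ring
      · have l1 : (j : ℝ) < code p 0 := by linarith
        have l2 : (code p 0 : ℝ) < j + 2 := by linarith
        have l3 : code p 0 = j + 1 := by
          have : j < code p 0 := by exact_mod_cast l1
          have : code p 0 < j + 2 := by exact_mod_cast l2
          omega
        rw [itm_of_le (mem_triangle (gauss_mem hp)) h', h5, l3]; push_cast; ring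
  refine Set.mem_iInter.2 fun n => ?_
  induction n generalizing x with
  | zero => exact ⟨x, hx, rfl⟩
  | succ n ih =>
    obtain ⟨y, hy, hy', rfl⟩ := step x hx h
    obtain ⟨z, hz, rfl⟩ := ih hy hy'
    exact ⟨z, hz, Function.iterate_succ_apply' _ _ _⟩

lemma closure_attractor_subset (p : ℝ × ℝ) : closure (attractor p) ⊆ Set.Icc 0 1 :=
  closure_minimal ((attractor_subset p).trans Set.Ico_subset_Icc_self) isClosed_Icc

lemma isCompact_closure_attractor (p : ℝ × ℝ) : IsCompact (closure (attractor p)) :=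
  isCompact_Icc.of_isClosed_subset isClosed_closure (closure_attractor_subset p)

lemma exists_baseMap_eq_of_mem_closure {p : ℝ × ℝ} (hp : p ∈ paramSet) {x : ℝ}
    (hx : x ∈ closure (attractor p)) (h : 1 - p.1 ≤ x) :
    ∃ y ∈ closure (attractor (gauss p)), baseMap p y = x := by
  rcases h.eq_or_lt with rfl | h
  · exact ⟨0, subset_closure (zero_mem_attractor (gauss_mem hp)), by simp [baseMap]⟩
  have hcl : IsClosed (baseMap p '' closure (attractor (gauss p))) :=
    ((isCompact_closure_attractor _).image (by unfold baseMap; fun_prop)).isClosed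
  have : x ∈ closure (attractor p ∩ Set.Ioi (1 - p.1)) := by
    rw [Set.inter_comm]
    exact isOpen_Ioi.inter_closure ⟨h, hx⟩
  refine closure_minimal ?_ hcl this
  rintro z ⟨hz, hz'⟩
  obtain ⟨y, hy, rfl⟩ := exists_baseMap_eq hp (le_of_lt hz') (attractor_subset p hz).2
  exact ⟨y, subset_closure (mem_attractor_gauss hp hy hz), rfl⟩

lemma exists_climb_of_mem_closure {p : ℝ × ℝ} (hp : p ∈ paramSet) {x : ℝ}
    (hx : x ∈ closure (attractor p)) (h : x < 1 - p.1) :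
    ∃ v ∈ closure (attractor (gauss p)), 1 - (gauss p).1 ≤ v ∧
      ∃ j : ℕ, x = baseMap p v + (p.2 - 1) + j * p.1 := by
  have ht := mem_triangle hp
  have h0 : 0 < p.1 := ht.1.trans ht.2.1
  have e1 := fst_mul_gauss_fst ht
  obtain ⟨J, hJ⟩ := exists_nat_gt (1 / p.1)
  rw [div_lt_iff₀ h0] at hJ
  set C := ⋃ j ∈ Finset.range J, (fun v => baseMap p v + (p.2 - 1) + j * p.1) ''
    (closure (attractor (gauss p)) ∩ Set.Ici (1 - (gauss p).1)) with hC
  have hcl : IsClosed C := isClosed_biUnion_finset fun j _ =>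
    (((isCompact_closure_attractor _).inter_right isClosed_Ici).image
      (by unfold baseMap; fun_prop)).isClosed
  have hmem : x ∈ closure (attractor p ∩ Set.Iio (1 - p.1)) := by
    rw [Set.inter_comm]
    exact isOpen_Iio.inter_closure ⟨h, hx⟩
  have hxC : x ∈ C := by
    refine closure_minimal ?_ hcl hmem
    rintro z ⟨hz, hz'⟩
    have hz' : z < 1 - p.1 := hz'
    obtain ⟨q, hq, hq1, ⟨h2, h3⟩ | ⟨h2, j, h3⟩⟩ := exists_last_visit ht hz
    · have := ht.1; linarith
    obtain ⟨v, hv, rfl⟩ := exists_baseMap_eq hp hq1 (attractor_subset p hq).2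
    have hb : 0 ≤ baseMap p v + (p.2 - 1) := by linarith
    refine Set.mem_biUnion (x := j) ?_
      ⟨v, ⟨subset_closure (mem_attractor_gauss hp hv hq), ?_⟩, h3.symm⟩
    · have : (j : ℝ) * p.1 < J * p.1 := by linarith
      simpa using lt_of_mul_lt_mul_right this h0.le
    · rw [Set.mem_Ici]
      simp only [baseMap] at h2
      nlinarith
  simp only [hC, Set.mem_iUnion] at hxC
  obtain ⟨j, -, v, ⟨hv, hv'⟩, rfl⟩ := hxC
  exact ⟨v, hv, hv', j, rfl⟩

/-- The images of the first two branches overlap, `x` and `x + α - β` having the same image. If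
both points lie in the closure of the attractor, the same happens for `gauss p`, with the distance
of `x` to `1 - α` scaled up; so this distance is bounded by all the lengths `ℓ_n`. -/
lemma one_sub_fst_sub_le_baseLength (n : ℕ) {p : ℝ × ℝ} (hp : p ∈ paramSet) {x : ℝ}
    (hx : x ∈ closure (attractor p)) (hx' : x + (p.1 - p.2) ∈ closure (attractor p))
    (h : x ≤ 1 - p.1) (h' : 1 - p.1 ≤ x + (p.1 - p.2)) :
    1 - p.1 - x ≤ baseLength p n := by
  induction n generalizing p x with
  | zero =>
    have := (closure_attractor_subset p hx).1
    have := (mem_triangle hp).1.trans (mem_triangle hp).2.1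
    rw [baseLength_zero]; linarith
  | succ n ih =>
    rcases h.eq_or_lt with rfl | h
    · rw [sub_self]; exact (baseLength_pos hp _).le
    have ht := mem_triangle hp
    have h0 : 0 < p.1 := ht.1.trans ht.2.1
    have e1 := fst_mul_gauss_fst ht
    have e2 := fst_mul_gauss_snd ht
    obtain ⟨g1, g2, g3⟩ := mem_triangle (gauss_mem hp)
    obtain ⟨y, hy, hyx⟩ := exists_baseMap_eq_of_mem_closure hp hx' h'
    obtain ⟨v, hv, hv1, j, hvx⟩ := exists_climb_of_mem_closure hp hx h
    obtain ⟨y0, y1⟩ := closure_attractor_subset _ hy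
    obtain ⟨v0, v1⟩ := closure_attractor_subset _ hv
    simp only [baseMap] at hyx hvx
    have e3 : v = y + ((gauss p).1 - (gauss p).2) + ((code p 0 : ℝ) - 1 - j) := by
      refine mul_left_cancel₀ h0.ne' ?_
      linarith
    have l1 : (j : ℝ) < code p 0 := by
      by_contra! hc
      nlinarith
    have l2 : (code p 0 : ℝ) < j + 2 := by linarith
    have l3 : code p 0 = j + 1 := by
      have : j < code p 0 := by exact_mod_cast l1
      have : code p 0 < j + 2 := by exact_mod_cast l2
      omega
    have e4 : v = y + ((gauss p).1 - (gauss p).2) := by rw [e3, l3]; push_cast; ring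
    have hy2 : y ≤ 1 - (gauss p).1 := by nlinarith
    have := ih (gauss_mem hp) hy (e4 ▸ hv) hy2 (e4 ▸ hv1)
    rw [baseLength_succ']
    have := mul_le_mul_of_nonneg_left this h0.le
    linarith

/-- The closure of the attractor does not contain two points with the same image under the first
two branches, apart from the pair `1 - α`, `1 - β`. -/
lemma eq_one_sub_fst {p : ℝ × ℝ} (hp : p ∈ paramSet) {x : ℝ}
    (hx : x ∈ closure (attractor p)) (hx' : x + (p.1 - p.2) ∈ closure (attractor p))
    (h : x ≤ 1 - p.1) (h' : 1 - p.1 ≤ x + (p.1 - p.2)) : x = 1 - p.1 := by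
  have : 1 - p.1 - x ≤ 0 := ge_of_tendsto' (tendsto_baseLength hp) fun n =>
    one_sub_fst_sub_le_baseLength n hp hx hx' h h'
  linarith
/-! ### One-sided limits of the dynamics -/

/-- If, along the orbit of `x` for the branch choice `b`, the branch choice `c` agrees with `b` at
the nearby points `· + u`, then the orbit of `x + u` for `c` stays parallel to that of `x`. -/
lemma eventually_iterate_add {t : Fin 3 → ℝ} {F : Filter ℝ} {b c : ℝ → Fin 3} {x : ℝ}
    (h : ∀ n : ℕ, ∀ᶠ u in F, c ((fun y => y + t (b y))^[n] x + u) =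
      b ((fun y => y + t (b y))^[n] x)) (n : ℕ) :
    ∀ᶠ u in F, (fun y => y + t (c y))^[n] (x + u) = (fun y => y + t (b y))^[n] x + u := by
  induction n with
  | zero => simp
  | succ n ih =>
    filter_upwards [ih, h n] with u h1 h2
    rw [Function.iterate_succ_apply', Function.iterate_succ_apply', h1, h2]
    ring

lemma iterate_eq_of_branch_eq {t : Fin 3 → ℝ} {b c : ℝ → Fin 3} {x : ℝ}
    (h : ∀ n : ℕ, c ((fun y => y + t (b y))^[n] x) = b ((fun y => y + t (b y))^[n] x)) (n : ℕ) :
    (fun y => y + t (c y))^[n] x = (fun y => y + t (b y))^[n] x := by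
  induction n with
  | zero => rfl
  | succ n ih => rw [Function.iterate_succ_apply', Function.iterate_succ_apply', ih, h]

lemma eventually_branch_right (p : ℝ × ℝ) (x : ℝ) :
    ∀ᶠ u in 𝓝[≥] (0 : ℝ), branch p (x + u) = branch p x := by
  have hlt : ∀ c : ℝ, x < c → ∀ᶠ u in 𝓝[≥] (0 : ℝ), x + u < c := fun c hc => by
    filter_upwards [mem_nhdsWithin_of_mem_nhds (Iio_mem_nhds (sub_pos.2 hc))] with u hu
    linarith [Set.mem_Iio.1 hu]
  have hge : ∀ c : ℝ, c ≤ x → ∀ᶠ u in 𝓝[≥] (0 : ℝ), c ≤ x + u := fun c hc => by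
    filter_upwards [self_mem_nhdsWithin] with u hu
    linarith [Set.mem_Ici.1 hu]
  have hiff : ∀ c : ℝ, ∀ᶠ u in 𝓝[≥] (0 : ℝ), (x + u < c ↔ x < c) := fun c => by
    rcases lt_or_ge x c with h | h
    · exact (hlt c h).mono fun u hu => iff_of_true hu h
    · exact (hge c h).mono fun u hu => iff_of_false hu.not_gt h.not_gt
  filter_upwards [hiff (1 - p.1), hiff (1 - p.2)] with u h1 h2
  simp only [branch, h1, h2]

lemma eventually_branch_left (p : ℝ × ℝ) (x : ℝ) :
    ∀ᶠ u in 𝓝[<] (0 : ℝ), branch p (x + u) = branchLeft p x := by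
  have hiff : ∀ c : ℝ, ∀ᶠ u in 𝓝[<] (0 : ℝ), (x + u < c ↔ x ≤ c) := fun c => by
    rcases le_or_gt x c with h | h
    · filter_upwards [self_mem_nhdsWithin] with u hu
      exact iff_of_true (by linarith [Set.mem_Iio.1 hu]) h
    · filter_upwards [mem_nhdsWithin_of_mem_nhds (Ioi_mem_nhds (sub_neg.2 h))] with u hu
      exact iff_of_false (by linarith [Set.mem_Ioi.1 hu]) h.not_ge
  filter_upwards [hiff (1 - p.1), hiff (1 - p.2)] with u h1 h2
  simp only [branch, branchLeft, h1, h2]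

lemma branchLeft_eq_branch {p : ℝ × ℝ} {x : ℝ} (h1 : x ≠ 1 - p.1) (h2 : x ≠ 1 - p.2) :
    branchLeft p x = branch p x := by
  simp only [branch, branchLeft, h1.le_iff_lt, h2.le_iff_lt]

lemma branchExt_eq_branch {p : ℝ × ℝ} {x : ℝ} (h1 : x ≠ 1 - p.1) (h2 : x ≠ 1 - p.2) :
    branchExt p x = branch p x := by
  rw [branchExt, branchLeft_eq_branch h1 h2, ite_self]

lemma eventually_branchExt {p : ℝ × ℝ} {x : ℝ} (h1 : x ≠ 1 - p.1) (h2 : x ≠ 1 - p.2) :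
    ∀ᶠ u in 𝓝 (0 : ℝ), branchExt p (x + u) = branchExt p x := by
  have ht : Tendsto (fun u : ℝ => x + u) (𝓝 0) (𝓝 x) := by
    simpa using (continuous_const_add x).tendsto (0 : ℝ)
  have hb : ∀ᶠ u in 𝓝 (0 : ℝ), branch p (x + u) = branch p x := by
    rw [← nhdsLT_sup_nhdsGE, eventually_sup]
    exact ⟨branchLeft_eq_branch h1 h2 ▸ eventually_branch_left p x, eventually_branch_right p x⟩
  filter_upwards [hb, ht.eventually_ne h1, ht.eventually_ne h2] with u hu hu1 hu2
  rw [branchExt_eq_branch h1 h2, branchExt_eq_branch hu1 hu2, hu]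

/-- The left-continuous version of the interval translation map. -/
noncomputable def leftItm (p : ℝ × ℝ) (x : ℝ) : ℝ := x + translation p (branchLeft p x)

/-- The itinerary of `x` under the left-continuous map `leftItm p`. -/
noncomputable def leftItin (p : ℝ × ℝ) (x : ℝ) (i : ℕ) : Fin 3 := branchLeft p ((leftItm p)^[i] x)

lemma eventually_rightItin_right (p : ℝ × ℝ) (x : ℝ) (n : ℕ) :
    ∀ᶠ u in 𝓝[≥] (0 : ℝ), rightItin p (x + u) n = rightItin p x n := by
  filter_upwards [eventually_iterate_add (t := translation p) (x := x)
    (fun n => eventually_branch_right p _) n, eventually_branch_right p ((itm p)^[n] x)] with u h1 h2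
  exact (congrArg (branch p) h1).trans h2

lemma eventually_rightItin_left (p : ℝ × ℝ) (x : ℝ) (n : ℕ) :
    ∀ᶠ u in 𝓝[<] (0 : ℝ), rightItin p (x + u) n = leftItin p x n := by
  filter_upwards [eventually_iterate_add (t := translation p) (x := x)
    (fun n => eventually_branch_left p _) n,
    eventually_branch_left p ((leftItm p)^[n] x)] with u h1 h2
  exact (congrArg (branch p) h1).trans h2

/-! ### The closure of the attractor -/

/-- The complement of `T^n [0, 1)` is right-open, as `T` translates the half-open branch
domains. -/
lemma eventually_notMem_image (p : ℝ × ℝ) (n : ℕ) {x : ℝ}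
    (hx : x ∉ (itm p)^[n] '' Set.Ico (0 : ℝ) 1) :
    ∀ᶠ u in 𝓝[≥] (0 : ℝ), x + u ∉ (itm p)^[n] '' Set.Ico (0 : ℝ) 1 := by
  induction n generalizing x with
  | zero =>
    simp only [Function.iterate_zero, Set.image_id, Set.mem_Ico, not_and, not_lt] at hx ⊢
    rcases lt_or_ge x 0 with h | h
    · filter_upwards [mem_nhdsWithin_of_mem_nhds (Iio_mem_nhds (sub_pos.2 h))] with u hu h0
      linarith [Set.mem_Iio.1 hu]
    · filter_upwards [self_mem_nhdsWithin] with u hu _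
      linarith [hx h, Set.mem_Ici.1 hu]
  | succ n ih =>
    have hi : ∀ i : Fin 3, ∀ᶠ u in 𝓝[≥] (0 : ℝ), ¬ (branch p (x - translation p i + u) = i ∧
        x - translation p i + u ∈ (itm p)^[n] '' Set.Ico (0 : ℝ) 1) := by
      intro i
      by_cases hb : branch p (x - translation p i) = i
      · refine (ih ?_).mono fun u hu hu' => hu hu'.2
        rintro ⟨z, hz, hzx⟩
        refine hx ⟨z, hz, ?_⟩
        rw [Function.iterate_succ_apply', hzx, itm, hb]; ring
      · exact (eventually_branch_right p _).mono fun u hu hu' => hb (hu.symm.trans hu'.1)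
    filter_upwards [eventually_all.2 hi] with u hu
    rintro ⟨z, hz, hzx⟩
    rw [Function.iterate_succ_apply', itm] at hzx
    have e : x - translation p (branch p ((itm p)^[n] z)) + u = (itm p)^[n] z := by
      linear_combination -hzx
    exact hu (branch p ((itm p)^[n] z)) (by rw [e]; exact ⟨rfl, z, hz, rfl⟩)

/-- The points of the closure outside the attractor are limits of the attractor from the left. -/
lemma frequently_left {p : ℝ × ℝ} {x : ℝ} (hx : x ∈ closure (attractor p))
    (hx' : x ∉ attractor p) : ∃ᶠ u in 𝓝[<] (0 : ℝ), x + u ∈ attractor p := by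
  have hr : ∀ᶠ u in 𝓝[≥] (0 : ℝ), x + u ∉ attractor p := by
    simp only [attractor, Set.mem_iInter, not_forall] at hx'
    obtain ⟨n, hn⟩ := hx'
    exact (eventually_notMem_image p n hn).mono fun u hu h => hu (Set.mem_iInter.1 h n)
  have ht : Tendsto (fun y : ℝ => y - x) (𝓝 x) (𝓝 0) := by
    simpa using (continuous_sub_right x).tendsto x
  have h0 : ∃ᶠ u in 𝓝 (0 : ℝ), x + u ∈ attractor p :=
    ht.frequently ((mem_closure_iff_frequently.1 hx).mono fun y hy => by simpa using hy)
  rw [← nhdsLT_sup_nhdsGE, frequently_sup] at h0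
  exact h0.resolve_right fun h => h hr

lemma mem_closure_of_frequently {s : Set ℝ} {x : ℝ} (h : ∃ᶠ u in 𝓝[<] (0 : ℝ), x + u ∈ s) :
    x ∈ closure s := by
  have ht : Tendsto (fun u : ℝ => x + u) (𝓝[<] 0) (𝓝 x) := by
    simpa using ((continuous_const_add x).tendsto (0 : ℝ)).mono_left nhdsWithin_le_nhds
  exact mem_closure_iff_frequently.2 (ht.frequently h)

lemma leftItm_mem_closure {p : ℝ × ℝ} (hp : p ∈ triangle) {x : ℝ}
    (hx : x ∈ closure (attractor p)) (hx' : x ∉ attractor p) :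
    leftItm p x ∈ closure (attractor p) := by
  refine mem_closure_of_frequently (((frequently_left hx hx').and_eventually
    (eventually_branch_left p x)).mono ?_)
  rintro u ⟨h1, h2⟩
  have := itm_mem_attractor hp h1
  rwa [itm, h2, add_right_comm] at this

lemma notMem_attractor_leftItm {p : ℝ × ℝ} (hp : p ∈ paramSet) {x : ℝ}
    (hx : x ∈ closure (attractor p)) (hx' : x ∉ attractor p) : leftItm p x ∉ attractor p := by
  intro h
  have ht := mem_triangle hp
  obtain ⟨h1, h2, h3⟩ := mem_triangle hp
  obtain ⟨y, hy, hyx⟩ := exists_itm_eq ht h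
  have hxne : x ≠ 1 - p.1 := fun e => hx' (e ▸ one_sub_fst_mem_attractor hp)
  have hxne' : x ≠ 1 - p.2 := fun e => hx' (e ▸ one_sub_snd_mem_attractor hp)
  have hyI := attractor_subset p hy
  have hxI := closure_attractor_subset p hx
  rw [leftItm, branchLeft_eq_branch hxne hxne'] at hyx
  change itm p y = itm p x at hyx
  have hyc := subset_closure hy
  rcases hxne.lt_or_gt with a | a <;> rcases hxne'.lt_or_gt with b | b <;>
    rcases lt_or_ge y (1 - p.1) with c | c <;> rcases lt_or_ge y (1 - p.2) with d | d <;>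
    first
    | linarith
    | skip
  · rw [itm_of_lt a, itm_of_lt c] at hyx
    exact hx' (by rwa [← add_right_cancel hyx])
  · rw [itm_of_lt a, itm_of_mem c d] at hyx
    have e : x + (p.1 - p.2) = y := by linarith
    exact hxne (eq_one_sub_fst hp hx (e ▸ hyc) a.le (e ▸ c))
  · rw [itm_of_lt a, itm_of_le ht d] at hyx
    linarith [hxI.1, hyI.2]
  · rw [itm_of_mem a.le b, itm_of_lt c] at hyx
    have e : y + (p.1 - p.2) = x := by linarith
    exact c.ne (eq_one_sub_fst hp hyc (e ▸ hx) c.le (e ▸ a.le))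
  · rw [itm_of_mem a.le b, itm_of_mem c d] at hyx
    exact hx' (by rwa [← add_right_cancel hyx])
  · rw [itm_of_mem a.le b, itm_of_le ht d] at hyx
    linarith [hyI.2]
  · rw [itm_of_le ht b.le, itm_of_lt c] at hyx
    linarith [hxI.2, hyI.1]
  · rw [itm_of_le ht b.le, itm_of_mem c d] at hyx
    linarith [hxI.2]
  · rw [itm_of_le ht b.le, itm_of_le ht d] at hyx
    exact hx' (by rwa [← add_right_cancel hyx])

lemma itmExt_of_mem {p : ℝ × ℝ} {x : ℝ} (hx : x ∈ attractor p) : itmExt p x = itm p x := by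
  rw [itmExt, branchExt, if_pos hx, itm]

lemma itmExt_of_notMem {p : ℝ × ℝ} {x : ℝ} (hx : x ∉ attractor p) :
    itmExt p x = leftItm p x := by
  rw [itmExt, branchExt, if_neg hx, leftItm]

lemma mapsTo_itmExt {p : ℝ × ℝ} (hp : p ∈ triangle) :
    Set.MapsTo (itmExt p) (closure (attractor p)) (closure (attractor p)) := by
  intro x hx
  by_cases h : x ∈ attractor p
  · rw [itmExt_of_mem h]
    exact subset_closure (itm_mem_attractor hp h)
  · rw [itmExt_of_notMem h]
    exact leftItm_mem_closure hp hx h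

lemma itinerary_of_mem {p : ℝ × ℝ} (hp : p ∈ triangle) {x : ℝ} (hx : x ∈ attractor p) :
    itinerary p x = rightItin p x := by
  have h : ∀ n, branchExt p ((itm p)^[n] x) = branch p ((itm p)^[n] x) := fun n =>
    if_pos (iterate_itm_mem_attractor hp hx n)
  funext i
  have e : (itmExt p)^[i] x = (itm p)^[i] x := iterate_eq_of_branch_eq h i
  rw [itinerary, e, h]; rfl

/-- A left orbit that starts outside the attractor never enters it, so the itinerary is the left
one. -/
lemma itinerary_of_notMem {p : ℝ × ℝ} (hp : p ∈ paramSet) {x : ℝ}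
    (hx : x ∈ closure (attractor p)) (hx' : x ∉ attractor p) :
    itinerary p x = leftItin p x := by
  have hmem : ∀ n, (leftItm p)^[n] x ∈ closure (attractor p) \ attractor p := fun n =>
    Set.MapsTo.iterate (f := leftItm p) (s := closure (attractor p) \ attractor p)
      (fun y hy => ⟨leftItm_mem_closure (mem_triangle hp) hy.1 hy.2,
        notMem_attractor_leftItm hp hy.1 hy.2⟩) n ⟨hx, hx'⟩
  have h : ∀ n, branchExt p ((leftItm p)^[n] x) = branchLeft p ((leftItm p)^[n] x) := fun n =>
    if_neg (hmem n).2
  funext i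
  have e : (itmExt p)^[i] x = (leftItm p)^[i] x := iterate_eq_of_branch_eq h i
  rw [itinerary, e, h]; rfl

/-! ### The exceptional set -/

lemma iterate_ne_of_notMem_exceptional {p : ℝ × ℝ} {x : ℝ}
    (hx : x ∈ closure (attractor p) \ exceptional p) (i : ℕ) :
    (itmExt p)^[i] x ≠ 1 - p.1 ∧ (itmExt p)^[i] x ≠ 1 - p.2 := by
  constructor
  · exact fun h => hx.2 ⟨hx.1, i, Or.inl h⟩
  · exact fun h => hx.2 ⟨hx.1, i, Or.inr h⟩

lemma iterate_itmExt_eq {p : ℝ × ℝ} {x : ℝ}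
    (hx : x ∈ closure (attractor p) \ exceptional p) (i : ℕ) :
    (itm p)^[i] x = (itmExt p)^[i] x :=
  iterate_eq_of_branch_eq (b := branchExt p) (c := branch p) (fun n =>
    (branchExt_eq_branch (iterate_ne_of_notMem_exceptional hx n).1
      (iterate_ne_of_notMem_exceptional hx n).2).symm) i

lemma itinerary_eq_rightItin {p : ℝ × ℝ} {x : ℝ}
    (hx : x ∈ closure (attractor p) \ exceptional p) : itinerary p x = rightItin p x := by
  funext i
  obtain ⟨h1, h2⟩ := iterate_ne_of_notMem_exceptional hx i
  rw [itinerary, branchExt_eq_branch h1 h2, ← iterate_itmExt_eq hx i]; rfl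

lemma itinerary_eq_leftItin {p : ℝ × ℝ} {x : ℝ}
    (hx : x ∈ closure (attractor p) \ exceptional p) : itinerary p x = leftItin p x := by
  have h : ∀ n, branchLeft p ((itmExt p)^[n] x) = branchExt p ((itmExt p)^[n] x) := fun n => by
    obtain ⟨h1, h2⟩ := iterate_ne_of_notMem_exceptional hx n
    rw [branchExt_eq_branch h1 h2, branchLeft_eq_branch h1 h2]
  funext i
  have e : (leftItm p)^[i] x = (itmExt p)^[i] x :=
    iterate_eq_of_branch_eq (b := branchExt p) (c := branchLeft p) h i
  rw [itinerary, leftItin, e, h]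

lemma continuousAt_itinerary {p : ℝ × ℝ} {x : ℝ}
    (hx : x ∈ closure (attractor p) \ exceptional p) : ContinuousAt (itinerary p) x := by
  rw [ContinuousAt, tendsto_pi_nhds]
  intro i
  have ht : Tendsto (fun y : ℝ => y - x) (𝓝 x) (𝓝 0) := by
    simpa using (continuous_sub_right x).tendsto x
  have hb : ∀ n : ℕ, ∀ᶠ u in 𝓝 (0 : ℝ), branchExt p ((itmExt p)^[n] x + u) =
      branchExt p ((itmExt p)^[n] x) := fun n =>
    eventually_branchExt (iterate_ne_of_notMem_exceptional hx n).1
      (iterate_ne_of_notMem_exceptional hx n).2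
  have he : ∀ᶠ u in 𝓝 (0 : ℝ), itinerary p (x + u) i = itinerary p x i := by
    filter_upwards [eventually_iterate_add (t := translation p) (x := x) hb i, hb i] with u h1 h2
    exact (congrArg (branchExt p) h1).trans h2
  refine tendsto_nhds_of_eventually_eq ((ht.eventually he).mono fun y hy => ?_)
  rwa [add_sub_cancel] at hy

/-- The orbit of `x` moves by integer combinations of `α` and `β` and `1`. -/
lemma countable_exceptional (p : ℝ × ℝ) : (exceptional p).Countable := by
  have h : ∀ (i : ℕ) (x : ℝ), ∃ a b c : ℤ, (itmExt p)^[i] x = x + a * p.1 + b * p.2 + c := by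
    intro i x
    induction i with
    | zero => exact ⟨0, 0, 0, by simp⟩
    | succ i ih =>
      obtain ⟨a, b, c, hx⟩ := ih
      rw [Function.iterate_succ_apply', hx, itmExt]
      generalize branchExt p _ = j
      fin_cases j
      · exact ⟨a + 1, b, c, by simp [translation]; ring⟩
      · exact ⟨a, b + 1, c, by simp [translation]; ring⟩
      · exact ⟨a, b + 1, c - 1, by simp [translation]; ring⟩
  refine (Set.countable_range fun z : ℤ × ℤ × ℤ => z.1 * p.1 + z.2.1 * p.2 + z.2.2).mono ?_
  rintro x ⟨-, i, hi⟩
  obtain ⟨a, b, c, hx⟩ := h i x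
  rw [hx] at hi
  rcases hi with hi | hi
  · exact ⟨(-a - 1, -b, 1 - c), by push_cast; linarith⟩
  · exact ⟨(-a, -b - 1, 1 - c), by push_cast; linarith⟩

lemma mapsTo_itmExt_diff {p : ℝ × ℝ} (hp : p ∈ triangle) :
    Set.MapsTo (itmExt p) (closure (attractor p) \ exceptional p)
      (closure (attractor p) \ exceptional p) := fun _ hx =>
  ⟨mapsTo_itmExt hp hx.1, fun h => hx.2 ⟨hx.1, h.2.imp' Nat.succ fun _ hi => hi⟩⟩

/-- The itinerary determines the point uniformly: two points with the same itinerary move in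
parallel until one of them is in `[1 - ℓ_n, 1)`, so their distance is at most `ℓ_n`. -/
lemma exists_abs_sub_lt {p : ℝ × ℝ} (hp : p ∈ paramSet) {ε : ℝ} (hε : 0 < ε) :
    ∃ N : ℕ, ∀ x ∈ closure (attractor p) \ exceptional p,
      ∀ y ∈ closure (attractor p) \ exceptional p,
      (∀ i < N, itinerary p x i = itinerary p y i) → |x - y| < ε := by
  obtain ⟨n, hn⟩ := ((tendsto_baseLength hp).eventually_lt_const hε).exists
  obtain ⟨R, hR⟩ := exists_entrance hp n
  have key : ∀ x ∈ closure (attractor p) \ exceptional p,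
      ∀ y ∈ closure (attractor p) \ exceptional p,
      (∀ i < R, itinerary p x i = itinerary p y i) → y - x < ε := by
    intro x hx y hy hxy
    by_contra! hc
    have hxI := closure_attractor_subset p hx.1
    have hyI := closure_attractor_subset p hy.1
    obtain ⟨j, hj, hj'⟩ := hR x ⟨hxI.1, by linarith [hyI.2]⟩
    have hpar : ∀ i ≤ R, (itmExt p)^[i] y = (itmExt p)^[i] x + (y - x) := by
      intro i hi
      induction i with
      | zero => simp
      | succ i ih =>
        have h1 : branchExt p ((itmExt p)^[i] x) = branchExt p ((itmExt p)^[i] y) :=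
          hxy i (by omega)
        rw [Function.iterate_succ_apply', Function.iterate_succ_apply', itmExt, itmExt, ← h1,
          ih (by omega)]
        ring
    have h1 := (closure_attractor_subset p
      (Set.MapsTo.iterate (mapsTo_itmExt (mem_triangle hp)) j hy.1)).2
    rw [hpar j hj, ← iterate_itmExt_eq hx] at h1
    linarith
  refine ⟨R, fun x hx y hy hxy => abs_sub_lt_iff.2 ⟨?_, ?_⟩⟩
  · exact key y hy x hx fun i hi => (hxy i hi).symm
  · exact key x hx y hy hxy

lemma eventually_prefix_eq (z : ℕ → Fin 3) (N : ℕ) : ∀ᶠ w in 𝓝 z, ∀ i < N, w i = z i := by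
  refine (Set.finite_lt_nat N).eventually_all.2 fun i _ => ?_
  exact (continuous_apply i).continuousAt.eventually ((isOpen_discrete {z i}).mem_nhds rfl)

lemma mem_closure_iff_prefix {S : Set (ℕ → Fin 3)} {z : ℕ → Fin 3} :
    z ∈ closure S ↔ ∀ N, ∃ w ∈ S, ∀ i < N, w i = z i := by
  constructor
  · intro h N
    obtain ⟨w, hw, hw'⟩ :=
      ((mem_closure_iff_frequently.1 h).and_eventually (eventually_prefix_eq z N)).exists
    exact ⟨w, hw, hw'⟩
  · intro h
    choose w hw hw' using h
    refine mem_closure_of_tendsto (f := w) (b := atTop) ?_ (Eventually.of_forall hw)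
    rw [tendsto_pi_nhds]
    refine fun i => tendsto_nhds_of_eventually_eq ?_
    filter_upwards [eventually_gt_atTop i] with N hN using hw' N i hN

lemma isEmbedding_itinerary {p : ℝ × ℝ} (hp : p ∈ paramSet) :
    Topology.IsEmbedding
      (fun x : ↥(closure (attractor p) \ exceptional p) => itinerary p (x : ℝ)) := by
  refine ⟨isInducing_iff_nhds.2 fun x => le_antisymm ?_ ?_, fun x y hxy => ?_⟩
  · rw [← tendsto_iff_comap]
    exact (continuousAt_itinerary x.2).tendsto.comp continuous_subtype_val.continuousAt
  · intro s hs
    obtain ⟨ε, hε, hs⟩ := Metric.mem_nhds_iff.1 hs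
    obtain ⟨N, hN⟩ := exists_abs_sub_lt hp hε
    refine mem_comap.2 ⟨_, eventually_prefix_eq (itinerary p x) N, fun y hy => hs ?_⟩
    exact hN y y.2 x x.2 hy
  · ext
    by_contra hne
    obtain ⟨N, hN⟩ := exists_abs_sub_lt hp (abs_pos.2 (sub_ne_zero.2 hne))
    exact lt_irrefl _ (hN x x.2 y y.2 fun i _ => congrFun hxy i)
/-! ### The limit word of the chain of substitutions -/

lemma chain_append (k : ℕ → ℕ) (n : ℕ) (u v : List (Fin 3)) :
    chain k n (u ++ v) = chain k n u ++ chain k n v := by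
  induction n generalizing u v with
  | zero => rfl
  | succ n ih => simp only [chain, List.flatMap_append, ih]

lemma chain_add (k : ℕ → ℕ) (n j : ℕ) (w : List (Fin 3)) :
    chain k (n + j) w = chain k n (chain (fun i => k (n + i)) j w) := by
  induction j generalizing w with
  | zero => rfl
  | succ j ih => exact ih _

lemma chain_ne_nil (k : ℕ → ℕ) (n : ℕ) {w : List (Fin 3)} (hw : w ≠ []) : chain k n w ≠ [] := by
  induction n generalizing w with
  | zero => exact hw
  | succ n ih =>
    refine ih fun h => ?_
    obtain ⟨a, v, rfl⟩ := List.exists_cons_of_ne_nil hw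
    rw [List.flatMap_cons, List.append_eq_nil_iff] at h
    have := h.1
    fin_cases a <;> simp [chi] at this

lemma chain_succ_two (k : ℕ → ℕ) (n : ℕ) :
    chain k (n + 1) [2] = chain k n [2] ++ chain k n (List.replicate (k n - 1) 0) := by
  rw [← chain_append]
  simp [chain, chi]

lemma chain_two_prefix (k : ℕ → ℕ) {m n : ℕ} (h : m ≤ n) : chain k m [2] <+: chain k n [2] := by
  induction n, h using Nat.le_induction with
  | base => exact List.prefix_rfl
  | succ n _ ih => exact ih.trans ⟨_, (chain_succ_two k n).symm⟩

lemma exists_lt_length_chain {k : ℕ → ℕ} (hk : k ∈ codeSet) (N : ℕ) :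
    ∃ n, N < (chain k n [2]).length := by
  obtain ⟨hk1, hk2⟩ := mem_codeSet_iff.1 hk
  induction N with
  | zero => exact ⟨0, by simp [chain]⟩
  | succ N ih =>
    obtain ⟨n, hn⟩ := ih
    obtain ⟨j, hj⟩ := hk2 n
    refine ⟨n + 2 * j + 1, ?_⟩
    have h1 := (chain_two_prefix k (Nat.le_add_right n (2 * j))).length_le
    have h2 : chain k (n + 2 * j) (List.replicate (k (n + 2 * j) - 1) 0) ≠ [] := by
      refine chain_ne_nil _ _ ?_
      have := hk1 (n + 2 * j)
      rw [Ne, List.replicate_eq_nil_iff]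
      omega
    have h3 := List.length_pos_of_ne_nil h2
    rw [chain_succ_two, List.length_append]
    omega

lemma exists_isChainLimit {k : ℕ → ℕ} (hk : k ∈ codeSet) : ∃ s, IsChainLimit k s := by
  choose n hn using exists_lt_length_chain hk
  refine ⟨fun i => (chain k (n i) [2])[i]'(hn i), fun i => ?_⟩
  filter_upwards [eventually_ge_atTop (n i)] with m hm
  rw [← List.getElem?_eq_getElem (hn i)]
  obtain ⟨t, ht⟩ := chain_two_prefix k hm
  rw [← ht, List.getElem?_append_left (hn i)]

lemma IsChainLimit.getElem? {k : ℕ → ℕ} {s : ℕ → Fin 3} (hs : IsChainLimit k s) {m i : ℕ}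
    (hi : i < (chain k m [2]).length) : (chain k m [2])[i]? = some (s i) := by
  obtain ⟨n, hn, hmn⟩ := ((hs i).and (eventually_ge_atTop m)).exists
  obtain ⟨t, ht⟩ := chain_two_prefix k hmn
  rw [← hn, ← ht, List.getElem?_append_left hi]

lemma zero_mem_chain {k : ℕ → ℕ} (hk : ∀ n, 1 ≤ k n) (j : ℕ) {w : List (Fin 3)} (hw : 0 ∈ w) :
    0 ∈ chain k (2 * j) w := by
  induction j generalizing w with
  | zero => exact hw
  | succ j ih =>
    refine ih (w := (w.flatMap (chi (k (2 * j + 1)))).flatMap (chi (k (2 * j)))) ?_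
    refine List.mem_flatMap.2 ⟨1, List.mem_flatMap.2 ⟨0, hw, by simp [chi]⟩, ?_⟩
    have := hk (2 * j)
    simp [chi]
    omega

/-- Every letter occurs in the words `χ_{k 0} ⋯ χ_{k (j-1)} (3)`: a letter `k_i ≠ 1` produces the
letter `1`, which alternates with the letter `2` under the substitutions before it. -/
lemma exists_mem_chain {k : ℕ → ℕ} (hk : k ∈ codeSet) (a : Fin 3) : ∃ j, a ∈ chain k j [2] := by
  obtain ⟨hk1, hk2⟩ := mem_codeSet_iff.1 hk
  have h0 : ∀ n, k n ≠ 1 → 0 ∈ ([2] : List (Fin 3)).flatMap (chi (k n)) := fun n hn => by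
    have := hk1 n
    simp [chi]
    omega
  fin_cases a
  · obtain ⟨j, hj⟩ := hk2 0
    rw [zero_add] at hj
    exact ⟨2 * j + 1, zero_mem_chain hk1 j (h0 _ hj)⟩
  · obtain ⟨j, hj⟩ := hk2 1
    refine ⟨2 * j + 2, ?_⟩
    change 1 ∈ chain k (2 * j + 1) (([2] : List (Fin 3)).flatMap (chi (k (2 * j + 1))))
    rw [chain_succ']
    refine List.mem_flatMap.2 ⟨0, zero_mem_chain (fun n => hk1 _) j (h0 _ ?_), by simp [chi]⟩
    rwa [add_comm]
  · exact ⟨0, by simp [chain]⟩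

lemma exists_chain_eq_append {k : ℕ → ℕ} (hk : k ∈ codeSet) (n : ℕ) (a : Fin 3) :
    ∃ m u v, chain k m [2] = u ++ (chain k n [a] ++ v) := by
  have hk' : (fun i => k (n + i)) ∈ codeSet := by
    rw [mem_codeSet_iff] at hk ⊢
    exact ⟨fun i => hk.1 _, fun i => by simpa only [add_assoc] using hk.2 (n + i)⟩
  obtain ⟨j, hj⟩ := exists_mem_chain hk' a
  obtain ⟨u, v, huv⟩ := List.append_of_mem hj
  refine ⟨n + j, chain k n u, chain k n v, ?_⟩
  rw [chain_add, huv, chain_append, ← List.singleton_append, chain_append]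

/-! ### Itineraries and the shift space -/

lemma shift_iterate (s : ℕ → Fin 3) (m i : ℕ) : (shift^[m] s) i = s (m + i) := by
  induction m generalizing s with
  | zero => simp
  | succ m ih =>
    rw [Function.iterate_succ_apply, ih, shift]
    congr 1
    ring

lemma mem_shiftSpace_iff {s z : ℕ → Fin 3} :
    z ∈ shiftSpace s ↔ ∀ N, ∃ m, ∀ i < N, s (m + i) = z i := by
  simp only [shiftSpace, mem_closure_iff_prefix, Set.exists_range_iff, shift_iterate]

lemma mapsTo_shift (s : ℕ → Fin 3) : Set.MapsTo shift (shiftSpace s) (shiftSpace s) := by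
  intro z hz
  rw [mem_shiftSpace_iff] at hz ⊢
  intro N
  obtain ⟨m, hm⟩ := hz (N + 1)
  refine ⟨m + 1, fun i hi => ?_⟩
  rw [show m + 1 + i = m + (i + 1) by ring, hm _ (by omega), shift]

/-- Up to time `N` a point of the attractor stays below `1 - ℓ_n` for large `n`. Following it back
to its last visit to `[1 - ℓ_n, 1)` shows that its first `N` letters are part of a word
`χ_{k 0} ⋯ χ_{k (n-1)} (a)`. -/
lemma rightItin_mem_shiftSpace {p : ℝ × ℝ} (hp : p ∈ paramSet) {s : ℕ → Fin 3}
    (hs : IsChainLimit (code p) s) {x : ℝ} (hx : x ∈ attractor p) :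
    rightItin p x ∈ shiftSpace s := by
  classical
  have ht := mem_triangle hp
  rw [mem_shiftSpace_iff]
  intro N
  obtain ⟨n, hn⟩ : ∃ n, ∀ i ≤ N, (itm p)^[i] x < 1 - baseLength p n := by
    refine Eventually.exists (f := atTop) ((Set.finite_le_nat N).eventually_all.2 fun i _ => ?_)
    have h1 := (attractor_subset p (iterate_itm_mem_attractor ht hx i)).2
    filter_upwards [(tendsto_baseLength hp).eventually_lt_const (sub_pos.2 h1)] with n hn
    linarith
  obtain ⟨R, hR⟩ := exists_entrance hp n
  obtain ⟨v, hv, hvx⟩ := Set.mem_iInter.1 hx R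
  obtain ⟨j₀, hj₀, hj₀'⟩ := hR v hv
  set P : ℕ → Prop := fun j => 1 - baseLength p n ≤ (itm p)^[j] v with hP
  set j := Nat.findGreatest P R with hj
  have hjR : j ≤ R := Nat.findGreatest_le R
  have hPj : P j := Nat.findGreatest_spec hj₀ hj₀'
  have hgr : ∀ i, j < i → i ≤ R → ¬ P i := fun i => Nat.findGreatest_is_greatest
  obtain ⟨y, hy, hyu⟩ := exists_levelMap_eq hp n hPj (iterate_itm_mem ht hv j).2
  set u := (itm p)^[j] v with hu
  have hux : (itm p)^[R - j] u = x := by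
    rw [hu, ← Function.iterate_add_apply, Nat.sub_add_cancel hjR, hvx]
  obtain ⟨h1, h2⟩ := itinWord_levelMap hp n hy 1
  rw [itinWord_one, hyu] at h1 h2
  set a := branch (gauss^[n] p) y
  set c := chain (code p) n [a] with hc
  have hc0 : 0 < c.length := List.length_pos_of_ne_nil (chain_ne_nil _ _ (by simp))
  have hge : 1 - baseLength p n ≤ (itm p)^[c.length] u := by
    rw [h2]
    exact le_levelMap hp n (itm_mem (hp n) hy).1
  have hlen : R - j + N < c.length := by
    by_contra! hcon
    rcases le_or_gt c.length (R - j) with h | h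
    · refine hgr (c.length + j) (by omega) (by omega) ?_
      rw [hP]
      simp only
      rwa [Function.iterate_add_apply]
    · have h3 := hn (c.length - (R - j)) (by omega)
      rw [← hux, ← Function.iterate_add_apply, Nat.sub_add_cancel h.le] at h3
      linarith
  obtain ⟨m, w₁, w₂, hm⟩ := exists_chain_eq_append (code_mem_codeSet hp) n a
  rw [← hc] at hm
  refine ⟨w₁.length + (R - j), fun i hi => ?_⟩
  have h4 : w₁.length + (R - j) + i < (chain (code p) m [2]).length := by
    rw [hm, List.length_append, List.length_append]
    omega
  have h5 := hs.getElem? h4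
  rw [hm, add_assoc, List.getElem?_append_right (Nat.le_add_right _ _), Nat.add_sub_cancel_left,
    List.getElem?_append_left (by omega), ← h1, getElem?_itinWord p u (by omega),
    Option.some_inj] at h5
  rw [add_assoc, ← h5, ← hux, rightItin_iterate p u, add_comm i]

lemma mapsTo_itinerary {p : ℝ × ℝ} (hp : p ∈ paramSet) {s : ℕ → Fin 3}
    (hs : IsChainLimit (code p) s) :
    Set.MapsTo (itinerary p) (closure (attractor p)) (shiftSpace s) := by
  intro x hx
  by_cases h : x ∈ attractor p
  · rw [itinerary_of_mem (mem_triangle hp) h]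
    exact rightItin_mem_shiftSpace hp hs h
  · rw [itinerary_of_notMem hp hx h]
    refine isClosed_closure.closure_subset (mem_closure_iff_prefix.2 fun N => ?_)
    have he : ∀ᶠ u in 𝓝[<] (0 : ℝ), ∀ i < N, rightItin p (x + u) i = leftItin p x i :=
      (Set.finite_lt_nat N).eventually_all.2 fun i _ => eventually_rightItin_left p x i
    obtain ⟨u, hu, hu'⟩ := ((frequently_left hx h).and_eventually he).exists
    exact ⟨_, rightItin_mem_shiftSpace hp hs hu, hu'⟩

/-- Prefixes of the limit word are prefixes of the itineraries of the points `1 - ℓ_n`. -/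
lemma exists_rightItin_eq {p : ℝ × ℝ} (hp : p ∈ paramSet) {s : ℕ → Fin 3}
    (hs : IsChainLimit (code p) s) (N : ℕ) :
    ∃ x ∈ attractor p, ∀ i < N, rightItin p x i = s i := by
  obtain ⟨n, hn⟩ := exists_lt_length_chain (code_mem_codeSet hp) N
  have hg := gauss_iterate_mem hp n
  have hmem := one_sub_snd_mem_attractor hg
  refine ⟨_, levelMap_mem_attractor hp n hmem, fun i hi => ?_⟩
  have h1 := (itinWord_levelMap hp n (attractor_subset _ hmem) 1).1
  rw [itinWord_one, branch_eq_two (hp n) le_rfl] at h1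
  have h2 := hs.getElem? (m := n) (hi.trans hn)
  rwa [← h1, getElem?_itinWord _ _ (hi.trans hn), Option.some_inj] at h2

/-- Each element of the shift space is a limit of itineraries of points `x_j` of the attractor. For
a limit point `x` of the `x_j` it is the itinerary of `x` from the right or from the left. -/
lemma exists_eq_rightItin_or_leftItin {p : ℝ × ℝ} (hp : p ∈ paramSet) {s : ℕ → Fin 3}
    (hs : IsChainLimit (code p) s) {z : ℕ → Fin 3} (hz : z ∈ shiftSpace s) :
    ∃ x ∈ closure (attractor p), z = rightItin p x ∨ z = leftItin p x := by
  have h : ∀ N, ∃ x ∈ attractor p, ∀ i < N, rightItin p x i = z i := fun N => by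
    obtain ⟨m, hm⟩ := mem_shiftSpace_iff.1 hz N
    obtain ⟨y, hy, hy'⟩ := exists_rightItin_eq hp hs (m + N)
    refine ⟨(itm p)^[m] y, iterate_itm_mem_attractor (mem_triangle hp) hy m, fun i hi => ?_⟩
    rw [rightItin_iterate, hy' _ (by omega), add_comm, hm i hi]
  choose y hy hyz using h
  obtain ⟨x, hx, φ, hφ, hlim⟩ :=
    (isCompact_closure_attractor p).tendsto_subseq fun N => subset_closure (hy N)
  have hlim0 : Tendsto (fun j => y (φ j) - x) atTop (𝓝 0) := by
    simpa using hlim.sub_const x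
  have hz' : ∀ i, ∀ᶠ j in atTop, rightItin p (y (φ j)) i = z i := fun i => by
    filter_upwards [eventually_gt_atTop i] with j hj using hyz _ i (hj.trans_le (hφ.id_le j))
  refine ⟨x, hx, ?_⟩
  by_cases hfr : ∃ᶠ j in atTop, x ≤ y (φ j)
  · refine Or.inl (funext fun i => ?_)
    have h1 := hlim0.eventually (eventually_nhdsWithin_iff.1 (eventually_rightItin_right p x i))
    obtain ⟨j, hj, h2, h3⟩ := (hfr.and_eventually (h1.and (hz' i))).exists
    have := h2 (sub_nonneg.2 hj)
    rw [add_sub_cancel] at this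
    rw [← h3, this]
  · refine Or.inr (funext fun i => ?_)
    have h1 := hlim0.eventually (eventually_nhdsWithin_iff.1 (eventually_rightItin_left p x i))
    obtain ⟨j, hj, h2, h3⟩ := ((not_frequently.1 hfr).and (h1.and (hz' i))).exists
    have := h2 (sub_neg.2 (not_le.1 hj))
    rw [add_sub_cancel] at this
    rw [← h3, this]

lemma countable_shiftSpace_diff {p : ℝ × ℝ} (hp : p ∈ paramSet) {s : ℕ → Fin 3}
    (hs : IsChainLimit (code p) s) :
    (shiftSpace s \ itinerary p '' (closure (attractor p) \ exceptional p)).Countable := by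
  refine (((countable_exceptional p).image (rightItin p)).union
    ((countable_exceptional p).image (leftItin p))).mono ?_
  rintro z ⟨hz, hz'⟩
  obtain ⟨x, hx, h⟩ := exists_eq_rightItin_or_leftItin hp hs hz
  have hxE : x ∈ exceptional p := by
    by_contra hxE
    refine hz' ⟨x, ⟨hx, hxE⟩, ?_⟩
    rcases h with rfl | rfl
    · exact itinerary_eq_rightItin ⟨hx, hxE⟩
    · exact itinerary_eq_leftItin ⟨hx, hxE⟩
  exact h.imp (fun h => ⟨x, hxE, h.symm⟩) fun h => ⟨x, hxE, h.symm⟩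

theorem theorem2p7 :
    ¬ paramSet.Countable ∧
    Set.BijOn code paramSet codeSet ∧
    ∀ p ∈ paramSet,
      ∃ s : ℕ → Fin 3, IsChainLimit (code p) s ∧
        -- the two systems and the coding map between them
        Set.MapsTo (itmExt p) (closure (attractor p)) (closure (attractor p)) ∧
        Set.MapsTo shift (shiftSpace s) (shiftSpace s) ∧
        Set.MapsTo (itinerary p) (closure (attractor p)) (shiftSpace s) ∧
        (∀ x ∈ closure (attractor p), itinerary p (itmExt p x) = shift (itinerary p x)) ∧
        -- the coding map is continuous at each point off the countable exceptional set, ...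
        (exceptional p).Countable ∧
        (∀ x ∈ closure (attractor p) \ exceptional p,
          ContinuousWithinAt (itinerary p) (closure (attractor p)) x) ∧
        -- ... the complement of this set is invariant, the coding map is there a homeomorphism
        -- onto its image, and the image is all of the shift space up to a countable set
        Set.MapsTo (itmExt p) (closure (attractor p) \ exceptional p)
          (closure (attractor p) \ exceptional p) ∧
        Topology.IsEmbedding
          (fun x : ↥(closure (attractor p) \ exceptional p) => itinerary p (x : ℝ)) ∧
        (shiftSpace s \ itinerary p '' (closure (attractor p) \ exceptional p)).Countable := by
  refine ⟨not_countable_paramSet, bijOn_code, fun p hp => ?_⟩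
  obtain ⟨s, hs⟩ := exists_isChainLimit (code_mem_codeSet hp)
  exact ⟨s, hs, mapsTo_itmExt (mem_triangle hp), mapsTo_shift s, mapsTo_itinerary hp hs,
    fun _ _ => rfl, countable_exceptional p,
    fun _ hx => (continuousAt_itinerary hx).continuousWithinAt,
    mapsTo_itmExt_diff (mem_triangle hp), isEmbedding_itinerary hp,
    countable_shiftSpace_diff hp hs⟩
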